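/- Let $J\in\{0,\tfrac12,1,\tfrac32,\dots\}$ and let $\mathcal H_J=\mathbb C^{2J+1}$ carry the spin-$J$ representation of $SU(2)$, with spin operators $\mathbf S=(S_x,S_y,S_z)$. For $\omega$ in the unit sphere $S^2\subset\mathbb R^3$ let $P_\omega=|\omega\rangle\langle\omega|$ be the coherent state projection, that is, the orthogonal projection onto the (one-dimensional) eigenspace of $\omega\cdot\mathbf S$ with eigenvalue $J$, and let $\uparrow$ be the north pole of $S^2$. Let $d\omega$ be the surface measure of $S^2$, of total mass $4\pi$. For a density matrix $\rho$ on $\mathcal H_J$ (a positive semi-definite operator of trace one) put $\langle\omega|\rho|\omega\rangle=\operatorname{Tr}(P_\omega\rho)\in[0,1]$. **Theorem 2.1** (Lower symbols of Bloch coherent states minimize concave averages). For every concave function $f:[0,1]\to\mathbb R$ and every density matrix $\rho$ on $\mathcal H_J$, $$\frac{2J+1}{4\pi}\int_{S^2} f\big(\langle\omega|\rho|\omega\rangle\big)\,d\omega\;\ge\;\frac{2J+1}{4\pi}\int_{S^2} f\big(|\langle\omega|{\uparrow}\rangle|^2\big)\,d\omega ,$$ both integrals being absolutely convergent. The right-hand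 side does not change if $\uparrow$ is replaced by any other point of $S^2$. The inequality remains true for concave $f:[0,1)\to\mathbb R$, which may tend to $-\infty$ at $1$ (any real value may be assigned to $f$ at $1$): the right-hand integral is then either absolutely convergent or $-\infty$, and if it is absolutely convergent, so is the left-hand one, and the inequality holds. For $f(t)=-t\ln t$ this is Lieb's 1978 conjecture that coherent states minimize the Wehrl entropy for Bloch spin-coherent states. -/

import Mathlib

noncomputable section

namespace BlochCoherent

/-- Euclidean three-space, with coordinates `0, 1, 2` for `x, y, z`. -/
abbrev R3 := EuclideanSpace ℝ (Fin 3)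

/-- The unit sphere of three-space. -/
abbrev S2 := Metric.sphere (0 : R3) 1

/-- The surface measure of the unit sphere, of total mass `4 * π`. -/
abbrev surface : MeasureTheory.Measure S2 :=
  (MeasureTheory.volume : MeasureTheory.Measure R3).toSphere

/-- The spin-`J` space `ℂ^(2J+1)`, where `n = 2J`. The basis vector with index `i` is the
weight vector `|m⟩` with `m = J - i`. -/
abbrev SpinSpace (n : ℕ) := EuclideanSpace ℂ (Fin (n + 1))

/-- The raising operator `S₊ = S_x + i S_y`:
`S₊ |m⟩ = √((J - m)(J + m + 1)) |m + 1⟩`; for `m = J - j` the radicand is `j (2J + 1 - j)`. -/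
def raising (n : ℕ) : Matrix (Fin (n + 1)) (Fin (n + 1)) ℂ :=
  Matrix.of fun i j =>
    if (i : ℕ) + 1 = (j : ℕ) then
      ((Real.sqrt ((j : ℝ) * ((n : ℝ) + 1 - (j : ℝ))) : ℝ) : ℂ)
    else 0

/-- `S_x = (S₊ + S₊*) / 2`. -/
def spinX (n : ℕ) : Matrix (Fin (n + 1)) (Fin (n + 1)) ℂ :=
  (1 / 2 : ℂ) • (raising n + (raising n).conjTranspose)

/-- `S_y = (S₊ - S₊*) / (2i)`. -/
def spinY (n : ℕ) : Matrix (Fin (n + 1)) (Fin (n + 1)) ℂ :=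
  (1 / (2 * Complex.I) : ℂ) • (raising n - (raising n).conjTranspose)

/-- `S_z |m⟩ = m |m⟩`. -/
def spinZ (n : ℕ) : Matrix (Fin (n + 1)) (Fin (n + 1)) ℂ :=
  Matrix.diagonal fun i => (n : ℂ) / 2 - (i : ℕ)

/-- The spin operator `ω · S` in the direction `ω`. -/
def spinDot (n : ℕ) (ω : S2) : SpinSpace n →ₗ[ℂ] SpinSpace n :=
  Matrix.toEuclideanLin
    (((ω.1 0 : ℝ) : ℂ) • spinX n + ((ω.1 1 : ℝ) : ℂ) • spinY n + ((ω.1 2 : ℝ) : ℂ) • spinZ n)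

/-- The coherent state projection `P_ω = |ω⟩⟨ω|`: the orthogonal projection onto the eigenspace
of `ω · S` for the maximal eigenvalue `J = n / 2`. -/
def coherentProj (n : ℕ) (ω : S2) : SpinSpace n →ₗ[ℂ] SpinSpace n :=
  (Module.End.eigenspace (spinDot n ω) ((n : ℂ) / 2)).starProjection.toLinearMap

/-- Density matrices: positive semi-definite operators of trace one. -/
def IsDensity {n : ℕ} (ρ : SpinSpace n →ₗ[ℂ] SpinSpace n) : Prop :=
  ρ.IsPositive ∧ LinearMap.trace ℂ (SpinSpace n) ρ = 1

/-- The lower symbol `⟨ω|ρ|ω⟩ = Tr (P_ω ρ)`, which is real for self-adjoint `ρ`. -/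
def lowerSymbol {n : ℕ} (ρ : SpinSpace n →ₗ[ℂ] SpinSpace n) (ω : S2) : ℝ :=
  (LinearMap.trace ℂ (SpinSpace n) (coherentProj n ω ∘ₗ ρ)).re

/-- `(2J+1)/(4π) ∫ f(⟨ω|ρ|ω⟩) dω`, where `n = 2J`. -/
def average {n : ℕ} (f : ℝ → ℝ) (ρ : SpinSpace n →ₗ[ℂ] SpinSpace n) : ℝ :=
  ((n : ℝ) + 1) / (4 * Real.pi) * ∫ ω, f (lowerSymbol ρ ω) ∂surface

/-- The integral in the average converges absolutely. -/
def AverageFinite {n : ℕ} (f : ℝ → ℝ) (ρ : SpinSpace n →ₗ[ℂ] SpinSpace n) : Prop :=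
  MeasureTheory.Integrable (fun ω => f (lowerSymbol ρ ω)) surface

/-- The north pole of the sphere. -/
def north : S2 := ⟨!₂[0, 0, 1], by simp [EuclideanSpace.norm_eq, Fin.sum_univ_three]⟩

end BlochCoherent

end

/-! ### Binomial identities and the norm of a product of binary forms. -/

noncomputable section

namespace BlochCoherent

open Finset

/-! The argument compares `ρ` with a quantum state on a much larger spin and passes to the classical
limit. View spin `n/2` as `Sym^n ℂ²`, the binary forms of degree `n`. For `N = n + k`, compress `ρ ⊗
1` from `Sym^n ⊗ Sym^k` to `Sym^N`; this is the universal cloning map up to a factor. A coherent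
vector is a pure tensor power, so the resulting operator `T` has the same expectation in coherent
states as `ρ` (`contract_coherentVec`).

The heart is that the spectrum of `T` is majorized by the numbers `C(N-i,n)/C(N,n)`, which form the
spectrum when `ρ` is coherent (`sum_norm_sq_contract_le`, `exists_majorized_spectrum`). This is
proved by induction on `k`. Duality and Bessel's inequality turn a sum of norms of contractions by
`φ` into a sum of norms of products `φ ψ_j` with `ψ_j` orthonormal. A normal ordering identity
(`sum_norm_mul_eq`, `choose_mul_norm_sq_formMul`) expresses these through contractions of `ψ_j` into
lower degree, where the induction hypothesis applies, and Vandermonde's identity sums the bounds.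

The lower symbol of `ρ` is an average of the eigenvalues of `T`, with weights whose integrals are
all equal because coherent states resolve the identity (`integral_lowerSymbol`). Jensen's inequality
(the Berezin–Lieb bound) followed by Karamata's inequality gives a lower bound for `∫ f(⟨ω|ρ|ω⟩)` by
a sum that depends only on `f`, `n`, `N` (`sum_le_integral_lowerSymbol`). As `N → ∞` this sum is a
Riemann sum for `∫₀¹ f(tⁿ) dt` (`tendsto_sum_choose`). By Archimedes' theorem on heights that is
exactly the coherent average.

For `f` concave on `[0,1)`, the result for `t ↦ f(s t)` with `s < 1` is extended to `s → 1` by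
Fatou's lemma on the side of `ρ` and dominated convergence on the coherent side. -/

theorem sum_square_eq_sum_diag {R : Type*} [AddCommMonoid R] (M : ℕ) (f : ℕ → ℕ → R)
    (hf : ∀ i j, M ≤ i + j → f i j = 0) :
    ∑ i ∈ range M, ∑ j ∈ range M, f i j = ∑ l ∈ range M, ∑ i ∈ range (l + 1), f i (l - i) := by
  rw [Finset.sum_range_diag_flip M f]
  refine sum_congr rfl fun i _ => ?_
  symm
  apply Finset.sum_subset (by intro x; simp; omega)
  intro j _ hj
  apply hf
  have : M - i ≤ j := by simpa using hj
  omega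

/-- Vandermonde's identity, weighted by a function of the total. -/
theorem sum_choose_mul_choose (i j : ℕ) (H : ℕ → ℂ) :
    ∑ p ∈ range (i + 1), ∑ d ∈ range (j + 1), ((i.choose p : ℂ) * (j.choose d : ℂ)) * H (p + d)
      = ∑ a ∈ range (i + j + 1), ((i + j).choose a : ℂ) * H a := by
  have h1 : ∀ a ∈ range (i + j + 1), ((i + j).choose a : ℂ) * H a
      = ∑ p ∈ range (a + 1), ((i.choose p : ℂ) * (j.choose (a - p) : ℂ)) * H (p + (a - p)) := by
    intro a _
    rw [Nat.add_choose_eq, Nat.cast_sum, Finset.sum_mul,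
      Finset.Nat.sum_antidiagonal_eq_sum_range_succ
        (fun p d => (((i.choose p * j.choose d : ℕ)) : ℂ) * H a)]
    refine sum_congr rfl fun p hp => ?_
    have : p ≤ a := by simpa [Nat.lt_succ_iff] using hp
    rw [Nat.add_sub_cancel' this]; push_cast; rfl
  rw [sum_congr rfl h1, Finset.sum_range_diag_flip (i + j + 1)
    (fun p d => ((i.choose p : ℂ) * (j.choose d : ℂ)) * H (p + d))]
  rw [← Finset.sum_subset (s₁ := range (i + 1)) (s₂ := range (i + j + 1)) (by intro x; simp; omega)]
  · refine sum_congr rfl fun p hp => ?_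
    have hp' : p ≤ i := by simpa [Nat.lt_succ_iff] using hp
    apply Finset.sum_subset (by intro x; simp; omega)
    intro d _ hd
    have : j < d := by simpa using hd
    simp [Nat.choose_eq_zero_of_lt this]
  · intro p _ hp
    have : i < p := by simpa using hp
    simp [Nat.choose_eq_zero_of_lt this]

/-- Both sides are the multinomial coefficient of `n` split into `p`, `l - p`, `c` and a remainder.
The guard is needed because `l - p` is truncated subtraction. -/
theorem choose_mul_choose_mul_choose (n l p c : ℕ) :
    n.choose l * l.choose p * (n - l).choose c
      = if p ≤ l then n.choose (p + c) * (p + c).choose p * (n - (p + c)).choose (l - p) else 0 := by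
  split_ifs with hp
  swap
  · simp [Nat.choose_eq_zero_of_lt (not_le.mp hp)]
  by_cases hn : p + c ≤ n
  swap
  · rw [Nat.choose_eq_zero_of_lt (not_le.mp hn)]
    rcases le_or_gt l n with h | h
    · rw [Nat.choose_eq_zero_of_lt (show n - l < c by omega)]; simp
    · simp [Nat.choose_eq_zero_of_lt h]
  by_cases hc : l + c ≤ n
  swap
  · rw [Nat.choose_eq_zero_of_lt (show n - (p + c) < l - p by omega)]
    rcases le_or_gt l n with h | h
    · rw [Nat.choose_eq_zero_of_lt (show n - l < c by omega)]; simp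
    · simp [Nat.choose_eq_zero_of_lt h]
  obtain ⟨u, rfl⟩ := Nat.exists_eq_add_of_le hp
  obtain ⟨e, rfl⟩ := Nat.exists_eq_add_of_le hc
  have e1 : p + u + c + e - (p + u) = c + e := by omega
  have e2 : p + u + c + e - (p + c) = u + e := by omega
  have e3 : p + u - p = u := by omega
  rw [e1, e2, e3]
  have h1 := Nat.choose_mul_factorial_mul_factorial (show p + u ≤ p + u + c + e by omega)
  have h2 := Nat.choose_mul_factorial_mul_factorial (show p ≤ p + u by omega)
  have h3 := Nat.choose_mul_factorial_mul_factorial (show c ≤ c + e by omega)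
  have h4 := Nat.choose_mul_factorial_mul_factorial (show p + c ≤ p + u + c + e by omega)
  have h5 := Nat.choose_mul_factorial_mul_factorial (show p ≤ p + c by omega)
  have h6 := Nat.choose_mul_factorial_mul_factorial (show u ≤ u + e by omega)
  rw [e1] at h1
  rw [e2] at h4
  simp only [Nat.add_sub_cancel_left] at h2 h3 h5 h6
  have P : 0 < p.factorial * u.factorial * c.factorial * e.factorial := by positivity
  apply Nat.eq_of_mul_eq_mul_right P
  calc _ = (p + u + c + e).choose (p + u) * ((p+u).choose p * p.factorial * u.factorial)
            * ((c+e).choose c * c.factorial * e.factorial) := by ring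
    _ = (p + u + c + e).choose (p + c) * ((p+c).choose p * p.factorial * c.factorial)
          * ((u+e).choose u * u.factorial * e.factorial) := by
      rw [h2, h3, h5, h6, h1, h4]
    _ = _ := by ring

/-- Vandermonde's identity: after reflecting the second binomial its lower index is `k - (l + d)`,
so the two lower indices add up to `k - (p + d)` for every `l`. -/
theorem sum_choose_sub_mul_choose_sub (A p q d k M : ℕ) (hqd : q + d ≤ k) (hM : k < M) :
    ∑ l ∈ range M, (if p ≤ l then A.choose (l - p) else 0)
        * (if q ≤ l then (k - (q + d)).choose (l - q) else 0)
      = if p + d ≤ k then (A + (k - (q + d))).choose (k - (p + d)) else 0 := by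
  have key : ∀ l, (if q ≤ l then (k - (q + d)).choose (l - q) else 0)
      = if l + d ≤ k then (k - (q + d)).choose (k - (l + d)) else 0 := by
    intro l
    split_ifs with h1 h2 h2
    · apply Nat.choose_symm_of_eq_add; omega
    · apply Nat.choose_eq_zero_of_lt; omega
    · symm; apply Nat.choose_eq_zero_of_lt; omega
    · rfl
  simp_rw [key]
  split_ifs with h
  · rw [Nat.add_choose_eq, Finset.Nat.sum_antidiagonal_eq_sum_range_succ
        (fun u v => A.choose u * (k - (q + d)).choose v)]
    symm
    apply Finset.sum_of_injOn (fun u => u + p)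
    · intro x _ y _ hxy; simpa using hxy
    · intro x hx
      have : x < k - (p + d) + 1 := by simpa using hx
      simp only [coe_range, Set.mem_Iio]; omega
    · intro l _ hl
      rcases Nat.lt_or_ge l p with h1 | h1
      · rw [if_neg (by omega)]; simp
      · rcases Nat.lt_or_ge k (l + d) with h2 | h2
        · rw [if_neg (not_le.mpr h2)]; simp
        · exact absurd ⟨l - p, by simp; omega, by simp; omega⟩ hl
    · intro u hu
      have : u < k - (p + d) + 1 := by simpa using hu
      rw [if_pos (by omega), if_pos (by omega), Nat.add_sub_cancel]
      congr 2; omega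
  · apply Finset.sum_eq_zero
    intro l _
    split_ifs <;> first | rfl | omega

theorem choose_mul_choose_mul_choose_add (n k s a : ℕ) (ha : a ≤ s) :
    (n + k).choose n * (n.choose (s - a) * k.choose a)
      = (n + k).choose s * (s.choose a * if a ≤ k then (n + k - s).choose (k - a) else 0) := by
  have h := choose_mul_choose_mul_choose (n + k) k a (s - a)
  rw [Nat.add_sub_cancel, Nat.add_sub_cancel' ha, ← Nat.choose_symm_add] at h
  have : (n + k).choose n * (n.choose (s - a) * k.choose a)
      = (n + k).choose n * k.choose a * n.choose (s - a) := by ring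
  rw [this, h]
  split_ifs <;> ring

/-- The norm of a product of binary forms as a sum over contractions. -/
theorem sum_norm_mul_eq (n k : ℕ) (x y : ℕ → ℂ) :
    ((n + k).choose n : ℂ) * ∑ l ∈ range (n + k + 1), (((n + k).choose l : ℂ))⁻¹ *
        (starRingEnd ℂ (∑ i ∈ range (l + 1), (n.choose i : ℂ) * (k.choose (l - i) : ℂ)
            * (x i * y (l - i)))
          * ∑ i ∈ range (l + 1), (n.choose i : ℂ) * (k.choose (l - i) : ℂ) * (x i * y (l - i)))
      = ∑ l ∈ range (n + k + 1), (n.choose l : ℂ) * (k.choose l : ℂ) *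
          ∑ c ∈ range (n + k + 1), ∑ d ∈ range (n + k + 1),
            ((n - l).choose c : ℂ) * ((k - l).choose d : ℂ) *
              (starRingEnd ℂ (∑ p ∈ range (n + k + 1), (l.choose p : ℂ)
                  * (starRingEnd ℂ (x (p + c)) * y (p + d)))
                * ∑ p ∈ range (n + k + 1), (l.choose p : ℂ)
                  * (starRingEnd ℂ (x (p + c)) * y (p + d))) := by
  set M := n + k + 1 with hM
  set G : ℕ → ℕ → ℕ → ℕ → ℂ := fun i i' j j' =>
    starRingEnd ℂ (x i) * x i' * (starRingEnd ℂ (y j) * y j') with hG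
  clear_value G
  -- Normal form for both sides: `i`, `j` index the conjugated coefficients of `x`, `y`. The other
  -- two indices have the same total `i + j`, so they are `i + j - a` and `a`.
  have L : ((n + k).choose n : ℂ) * ∑ l ∈ range M, (((n + k).choose l : ℂ))⁻¹ *
        (starRingEnd ℂ (∑ i ∈ range (l + 1), (n.choose i : ℂ) * (k.choose (l - i) : ℂ)
            * (x i * y (l - i)))
          * ∑ i ∈ range (l + 1), (n.choose i : ℂ) * (k.choose (l - i) : ℂ) * (x i * y (l - i)))
      = ∑ i ∈ range M, ∑ j ∈ range M, (n.choose i : ℂ) * (k.choose j : ℂ) *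
          ∑ a ∈ range (i + j + 1), ((i + j).choose a : ℂ) *
            ((((if a ≤ k then (n + k - (i + j)).choose (k - a) else 0 : ℕ)) : ℂ)
              * G i (i + j - a) j a) := by
    rw [sum_square_eq_sum_diag]
    swap
    · intro i j hij
      rcases Nat.lt_or_ge n i with h | h
      · simp [Nat.choose_eq_zero_of_lt h]
      · simp [Nat.choose_eq_zero_of_lt (show k < j by omega)]
    rw [Finset.mul_sum]
    refine sum_congr rfl fun l hl => ?_
    have hl' : l ≤ n + k := by simp [hM] at hl; omega
    have hl0 : ((n + k).choose l : ℂ) ≠ 0 := by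
      exact_mod_cast (Nat.choose_pos hl').ne'
    rw [map_sum, Finset.sum_mul, Finset.mul_sum, Finset.mul_sum]
    refine sum_congr rfl fun i hi => ?_
    have hi' : i ≤ l := by simp at hi; omega
    rw [Nat.add_sub_cancel' hi', ← Finset.sum_range_reflect, Finset.mul_sum, Finset.mul_sum,
      Finset.mul_sum, Finset.mul_sum]
    refine sum_congr rfl fun a ha => ?_
    have ha' : a ≤ l := by simp at ha; omega
    have e1 : l + 1 - 1 - a = l - a := by omega
    have e2 : l - (l - a) = a := by omega
    rw [e1, e2]
    have h := congrArg (Nat.cast (R := ℂ)) (choose_mul_choose_mul_choose_add n k l a ha')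
    push_cast at h
    simp only [map_mul, Complex.conj_natCast, hG]
    push_cast
    calc _ = (n.choose i : ℂ) * (k.choose (l - i) : ℂ) * ((((n + k).choose l : ℂ))⁻¹ *
          (((n + k).choose n : ℂ) * ((n.choose (l - a) : ℂ) * (k.choose a : ℂ)))
            * (starRingEnd ℂ (x i) * x (l - a) * (starRingEnd ℂ (y (l - i)) * y a))) := by ring
      _ = _ := by rw [h]; field_simp
  rw [L]
  -- Expand the square. The four coefficients have indices `p + c`, `q + c`, `q + d`, `p + d`, and
  -- the `l`-dependent weight is rewritten so that `l` survives in only two binomials.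
  have Rr : ∀ l ∈ range M, (n.choose l : ℂ) * (k.choose l : ℂ) *
          ∑ c ∈ range M, ∑ d ∈ range M,
            ((n - l).choose c : ℂ) * ((k - l).choose d : ℂ) *
              (starRingEnd ℂ (∑ p ∈ range M, (l.choose p : ℂ)
                  * (starRingEnd ℂ (x (p + c)) * y (p + d)))
                * ∑ p ∈ range M, (l.choose p : ℂ)
                  * (starRingEnd ℂ (x (p + c)) * y (p + d)))
      = ∑ p ∈ range M, ∑ c ∈ range M, ∑ d ∈ range M, ∑ q ∈ range M,
          ((if p ≤ l then n.choose (p + c) * (p + c).choose p * (n - (p + c)).choose (l - p)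
            else 0 : ℕ) : ℂ)
            * ((if q ≤ l then k.choose (q + d) * (q + d).choose q * (k - (q + d)).choose (l - q)
              else 0 : ℕ) : ℂ)
            * G (p + c) (q + c) (q + d) (p + d) := by
    intro l _
    rw [Finset.mul_sum]
    conv_rhs => rw [Finset.sum_comm]
    refine sum_congr rfl fun c _ => ?_
    rw [Finset.mul_sum]
    conv_rhs => rw [Finset.sum_comm]
    refine sum_congr rfl fun d _ => ?_
    rw [mul_comm (starRingEnd ℂ _), Finset.sum_mul, Finset.mul_sum, Finset.mul_sum]
    refine sum_congr rfl fun p _ => ?_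
    rw [map_sum, Finset.mul_sum, Finset.mul_sum, Finset.mul_sum]
    refine sum_congr rfl fun q _ => ?_
    rw [← choose_mul_choose_mul_choose, ← choose_mul_choose_mul_choose]
    simp only [map_mul, Complex.conj_natCast, Complex.conj_conj, hG]
    push_cast
    ring
  rw [sum_congr rfl Rr]
  conv_rhs => rw [Finset.sum_comm]
  -- The coefficients of `x`, `y` do not involve `l`, so the sum over `l` is a Vandermonde sum.
  have S : ∀ p ∈ range M, ∑ l ∈ range M, ∑ c ∈ range M, ∑ d ∈ range M, ∑ q ∈ range M,
          ((if p ≤ l then n.choose (p + c) * (p + c).choose p * (n - (p + c)).choose (l - p)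
            else 0 : ℕ) : ℂ)
            * ((if q ≤ l then k.choose (q + d) * (q + d).choose q * (k - (q + d)).choose (l - q)
              else 0 : ℕ) : ℂ)
            * G (p + c) (q + c) (q + d) (p + d)
      = ∑ c ∈ range M, ∑ d ∈ range M, ∑ q ∈ range M,
          ((n.choose (p + c) * (p + c).choose p * (k.choose (d + q) * (d + q).choose d) : ℕ) : ℂ) *
          (((if p + d ≤ k then (n + k - (p + c + (d + q))).choose (k - (p + d)) else 0 : ℕ) : ℂ)
            * G (p + c) (p + c + (d + q) - (p + d)) (d + q) (p + d)) := by
    intro p _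
    rw [Finset.sum_comm]
    refine sum_congr rfl fun c _ => ?_
    rw [Finset.sum_comm]
    refine sum_congr rfl fun d _ => ?_
    rw [Finset.sum_comm]
    refine sum_congr rfl fun q _ => ?_
    rw [← Finset.sum_mul]
    rcases Nat.lt_or_ge n (p + c) with h1 | h1
    · simp [Nat.choose_eq_zero_of_lt h1]
    rcases Nat.lt_or_ge k (q + d) with h2 | h2
    · simp [Nat.choose_eq_zero_of_lt h2, add_comm d q]
    have h := sum_choose_sub_mul_choose_sub (n - (p + c)) p q d k M h2 (by omega)
    have e1 : n - (p + c) + (k - (q + d)) = n + k - (p + c + (d + q)) := by omega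
    have e2 : p + c + (d + q) - (p + d) = q + c := by omega
    rw [e1] at h
    rw [← h, e2, ← mul_assoc, add_comm d q, ← Nat.choose_symm_add (a := q) (b := d)]
    generalize G (p + c) (q + c) (q + d) (p + d) = g
    congr 1
    push_cast
    rw [Finset.mul_sum]
    refine sum_congr rfl fun l _ => ?_
    split_ifs <;> ring
  rw [sum_congr rfl S]
  symm
  rw [sum_square_eq_sum_diag]
  swap
  · intro p c hpc
    refine Finset.sum_eq_zero fun d _ => Finset.sum_eq_zero fun q _ => ?_
    simp [Nat.choose_eq_zero_of_lt (show n < p + c by omega)]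
  refine sum_congr rfl fun i _ => ?_
  -- Regroup by `i = p + c` and `j = d + q`. The summand then depends on `p`, `d` only through `a =
  -- p + d`, apart from the Vandermonde weights.
  have T : ∀ p ∈ range (i + 1), ∑ d ∈ range M, ∑ q ∈ range M,
          ((n.choose (p + (i - p)) * (p + (i - p)).choose p * (k.choose (d + q) * (d + q).choose d)
            : ℕ) : ℂ) *
          (((if p + d ≤ k then (n + k - (p + (i - p) + (d + q))).choose (k - (p + d)) else 0 : ℕ)
            : ℂ) * G (p + (i - p)) (p + (i - p) + (d + q) - (p + d)) (d + q) (p + d))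
      = ∑ j ∈ range M, (n.choose i : ℂ) * (k.choose j : ℂ) * ∑ d ∈ range (j + 1),
          ((i.choose p : ℂ) * (j.choose d : ℂ)) *
          (((if p + d ≤ k then (n + k - (i + j)).choose (k - (p + d)) else 0 : ℕ)
            : ℂ) * G i (i + j - (p + d)) j (p + d)) := by
    intro p hp
    have hp' : p ≤ i := by simp at hp; omega
    rw [sum_square_eq_sum_diag]
    swap
    · intro d q hdq
      simp [Nat.choose_eq_zero_of_lt (show k < d + q by omega)]
    refine sum_congr rfl fun j _ => ?_
    rw [Finset.mul_sum]
    refine sum_congr rfl fun d hd => ?_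
    have hd' : d ≤ j := by simp at hd; omega
    rw [Nat.add_sub_cancel' hp', Nat.add_sub_cancel' hd']
    push_cast
    ring
  rw [sum_congr rfl T, Finset.sum_comm]
  refine sum_congr rfl fun j _ => ?_
  rw [← Finset.mul_sum, ← sum_choose_mul_choose i j (fun a =>
    (((if a ≤ k then (n + k - (i + j)).choose (k - a) else 0 : ℕ) : ℂ) * G i (i + j - a) j a))]

end BlochCoherent

end

/-! ### Spin space as binary forms: products, contractions, and the majorization bound. -/

noncomputable section

namespace BlochCoherent

open Finset

/-- The coefficients of `φ`, read as the binary form `∑ C(n,i) x_i X^(n-i) Y^i`. -/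
def coeffs {n : ℕ} (φ : SpinSpace n) (i : ℕ) : ℂ :=
  if h : i < n + 1 then φ ⟨i, h⟩ / (√(n.choose i : ℝ) : ℂ) else 0

/-- The vector with given coefficients as a binary form. -/
def ofCoeffs (n : ℕ) (x : ℕ → ℂ) : SpinSpace n :=
  WithLp.toLp 2 fun i => (√(n.choose i : ℝ) : ℂ) * x i

theorem sqrt_choose_ne_zero {n i : ℕ} (h : i ≤ n) : (√(n.choose i : ℝ) : ℂ) ≠ 0 := by
  have : (0 : ℝ) < n.choose i := by exact_mod_cast Nat.choose_pos h
  exact_mod_cast (Real.sqrt_pos.mpr this).ne'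

theorem sqrt_choose_mul_self (n i : ℕ) :
    (√(n.choose i : ℝ) : ℂ) * (√(n.choose i : ℝ) : ℂ) = (n.choose i : ℂ) := by
  rw [← Complex.ofReal_mul, Real.mul_self_sqrt (by positivity)]; simp

theorem coeffs_ofCoeffs {n i : ℕ} (x : ℕ → ℂ) (h : i ≤ n) : coeffs (ofCoeffs n x) i = x i := by
  rw [coeffs, dif_pos (by omega)]
  simp only [ofCoeffs]
  rw [mul_div_cancel_left₀ _ (sqrt_choose_ne_zero h)]

theorem coeffs_eq_zero {n i : ℕ} (φ : SpinSpace n) (h : n < i) : coeffs φ i = 0 := by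
  rw [coeffs, dif_neg (by omega)]

theorem apply_eq_coeffs {n : ℕ} (φ : SpinSpace n) (i : Fin (n + 1)) :
    φ i = (√(n.choose i : ℝ) : ℂ) * coeffs φ i := by
  rw [coeffs, dif_pos i.2, mul_div_cancel₀ _ (sqrt_choose_ne_zero (by omega))]

theorem inner_eq_sum_coeffs {n : ℕ} (φ ψ : SpinSpace n) :
    inner ℂ φ ψ = ∑ i ∈ range (n + 1), (n.choose i : ℂ)
      * (starRingEnd ℂ (coeffs φ i) * coeffs ψ i) := by
  rw [PiLp.inner_apply, Finset.sum_range]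
  refine sum_congr rfl fun i _ => ?_
  rw [apply_eq_coeffs φ, apply_eq_coeffs ψ, ← sqrt_choose_mul_self]
  simp
  ring

theorem norm_sq_eq_sum_coeffs {n : ℕ} (φ : SpinSpace n) :
    ((‖φ‖ ^ 2 : ℝ) : ℂ) = ∑ i ∈ range (n + 1), (n.choose i : ℂ)
      * (starRingEnd ℂ (coeffs φ i) * coeffs φ i) := by
  rw [← inner_eq_sum_coeffs, inner_self_eq_norm_sq_to_K]; simp

/-- The product of binary forms, of total degree `N`. -/
def formMul (N : ℕ) {n k : ℕ} (φ : SpinSpace n) (ψ : SpinSpace k) : SpinSpace N :=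
  ofCoeffs N fun l => ((N.choose l : ℂ))⁻¹ * ∑ i ∈ range (l + 1),
    (n.choose i : ℂ) * (k.choose (l - i) : ℂ) * (coeffs φ i * coeffs ψ (l - i))

/-- The contraction of `u` with `χ`, the adjoint of multiplication by `χ`. -/
def contract (k : ℕ) {a N : ℕ} (χ : SpinSpace a) (u : SpinSpace N) : SpinSpace k :=
  ofCoeffs k fun b => ∑ j ∈ range (a + 1),
    (a.choose j : ℂ) * (starRingEnd ℂ (coeffs χ j) * coeffs u (j + b))

theorem inner_formMul {a k N : ℕ} (h : a + k = N) (χ : SpinSpace a) (ψ : SpinSpace k)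
    (u : SpinSpace N) : inner ℂ (formMul N χ ψ) u = inner ℂ ψ (contract k χ u) := by
  subst h
  rw [inner_eq_sum_coeffs, inner_eq_sum_coeffs]
  have h1 : ∀ l ∈ range (a + k + 1), ((a + k).choose l : ℂ)
      * (starRingEnd ℂ (coeffs (formMul (a + k) χ ψ) l) * coeffs u l)
      = ∑ i ∈ range (l + 1), (a.choose i : ℂ) * (k.choose (l - i) : ℂ)
        * (starRingEnd ℂ (coeffs χ i * coeffs ψ (l - i)) * coeffs u (i + (l - i))) := by
    intro l hl
    have hl' : l ≤ a + k := by simp at hl; omega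
    have h0 : ((a + k).choose l : ℂ) ≠ 0 := by exact_mod_cast (Nat.choose_pos hl').ne'
    rw [formMul, coeffs_ofCoeffs _ hl', map_mul, map_inv₀, Complex.conj_natCast, map_sum,
      ← mul_assoc, ← mul_assoc, mul_inv_cancel₀ h0, one_mul, Finset.sum_mul]
    refine sum_congr rfl fun i hi => ?_
    have hi' : i ≤ l := by simp at hi; omega
    rw [Nat.add_sub_cancel' hi']
    simp only [map_mul, Complex.conj_natCast]
    ring
  rw [sum_congr rfl h1, ← sum_square_eq_sum_diag (a + k + 1) (fun i j =>
    (a.choose i : ℂ) * (k.choose j : ℂ)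
        * (starRingEnd ℂ (coeffs χ i * coeffs ψ j) * coeffs u (i + j)))]
  swap
  · intro i j hij
    rw [coeffs_eq_zero u (by omega)]; simp
  rw [Finset.sum_comm, ← Finset.sum_subset (s₁ := range (k + 1)) (by intro x; simp; omega)]
  · refine sum_congr rfl fun j hj => ?_
    have hj' : j ≤ k := by simp at hj; omega
    rw [contract, coeffs_ofCoeffs _ hj', ← Finset.sum_subset (s₁ := range (a + 1))
      (s₂ := range (a + k + 1)) (by intro x; simp; omega), Finset.mul_sum, Finset.mul_sum]
    · refine sum_congr rfl fun i _ => ?_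
      rw [map_mul]; ring
    · intro i _ hi
      rw [coeffs_eq_zero χ (by simpa using hi)]; simp
  · intro j _ hj
    refine Finset.sum_eq_zero fun i _ => ?_
    rw [coeffs_eq_zero ψ (by simpa using hj)]; simp

/-- The partial derivatives of `φ` of degree `l`, normalized. -/
def part (l c : ℕ) {n : ℕ} (φ : SpinSpace n) : SpinSpace l :=
  ofCoeffs l fun p => (√((n - l).choose c : ℝ) : ℂ) * coeffs φ (p + c)

/-- The parts are the components of `φ` under the isometric inclusion of `Sym^n` in `Sym^(n-l) ⊗
Sym^l`, along the weight basis of the first factor; in coordinates, Vandermonde. -/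
theorem sum_norm_sq_part {n l : ℕ} (hl : l ≤ n) (φ : SpinSpace n) :
    ∑ c ∈ range (n - l + 1), ‖part l c φ‖ ^ 2 = ‖φ‖ ^ 2 := by
  apply Complex.ofReal_injective
  rw [Complex.ofReal_sum, norm_sq_eq_sum_coeffs]
  have h := sum_choose_mul_choose (n - l) l (fun i => starRingEnd ℂ (coeffs φ i) * coeffs φ i)
  rw [Nat.sub_add_cancel hl] at h
  rw [← h]
  refine sum_congr rfl fun c _ => ?_
  rw [norm_sq_eq_sum_coeffs]
  refine sum_congr rfl fun p hp => ?_
  have hp' : p ≤ l := by simp at hp; omega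
  rw [part, coeffs_ofCoeffs _ hp', map_mul, Complex.conj_ofReal, ← sqrt_choose_mul_self (n - l) c,
    add_comm c p]
  ring

/-- Normal ordering: in `⟨φψ, φψ⟩`, `n` annihilation operators are moved past `n` creation
operators, and `l` counts those that reach `ψ`. The terms with `l ≥ 1` lower the degree of `ψ`,
which drives the induction in `sum_norm_sq_contract_le`. -/
theorem choose_mul_norm_sq_formMul {n k N : ℕ} (h : n + k = N) (φ : SpinSpace n)
    (ψ : SpinSpace k) :
    (N.choose n : ℝ) * ‖formMul N φ ψ‖ ^ 2
      = ∑ l ∈ range (N + 1), (n.choose l : ℝ) * (k.choose l : ℝ) *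
          ∑ c ∈ range (n - l + 1), ‖contract (k - l) (part l c φ) ψ‖ ^ 2 := by
  subst h
  apply Complex.ofReal_injective
  have := sum_norm_mul_eq n k (coeffs φ) (coeffs ψ)
  rw [Complex.ofReal_mul, norm_sq_eq_sum_coeffs, Complex.ofReal_sum]
  refine Eq.trans ?_ (this.trans ?_)
  · push_cast
    congr 1
    refine sum_congr rfl fun l hl => ?_
    have hl' : l ≤ n + k := by simp at hl; omega
    have h0 : ((n + k).choose l : ℂ) ≠ 0 := by exact_mod_cast (Nat.choose_pos hl').ne'
    rw [formMul, coeffs_ofCoeffs _ hl', map_mul, map_inv₀, Complex.conj_natCast]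
    field_simp
  · refine sum_congr rfl fun l _ => ?_
    rw [Complex.ofReal_mul, Complex.ofReal_sum]
    push_cast
    rcases Nat.lt_or_ge n l with hn | hn
    · simp [Nat.choose_eq_zero_of_lt hn]
    rcases Nat.lt_or_ge k l with hk | hk
    · simp [Nat.choose_eq_zero_of_lt hk]
    congr 1
    symm
    apply Finset.sum_subset_zero_on_sdiff (by intro x; simp; omega)
    · intro c hc
      have : n - l < c := by simp at hc; omega
      simp [Nat.choose_eq_zero_of_lt this]
    · intro c _
      rw [← Complex.ofReal_pow, norm_sq_eq_sum_coeffs]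
      apply Finset.sum_subset_zero_on_sdiff (by intro x; simp; omega)
      · intro d hd
        have : k - l < d := by simp at hd; omega
        simp [Nat.choose_eq_zero_of_lt this]
      · intro d hd
        have hd' : d ≤ k - l := by simp at hd; omega
        have e : coeffs (contract (k - l) (part l c φ) ψ) d = (√((n - l).choose c : ℝ) : ℂ) *
            ∑ p ∈ range (n + k + 1), (l.choose p : ℂ)
              * (starRingEnd ℂ (coeffs φ (p + c)) * coeffs ψ (p + d)) := by
          rw [contract, coeffs_ofCoeffs _ hd', Finset.mul_sum]
          apply Finset.sum_subset_zero_on_sdiff (by intro x; simp; omega)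
          · intro p hp
            have : l < p := by simp at hp; omega
            simp [Nat.choose_eq_zero_of_lt this]
          · intro p hp
            have hp' : p ≤ l := by simp at hp; omega
            rw [part, coeffs_ofCoeffs _ hp', map_mul, Complex.conj_ofReal]
            ring
        rw [e, map_mul, Complex.conj_ofReal, ← sqrt_choose_mul_self (n - l) c]
        ring

theorem norm_sq_contract_zero {k : ℕ} (χ : SpinSpace 0) (u : SpinSpace k) :
    ‖contract k χ u‖ ^ 2 = ‖χ‖ ^ 2 * ‖u‖ ^ 2 := by
  apply Complex.ofReal_injective
  rw [Complex.ofReal_mul, norm_sq_eq_sum_coeffs, norm_sq_eq_sum_coeffs, norm_sq_eq_sum_coeffs,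
    Finset.mul_sum]
  refine sum_congr rfl fun i hi => ?_
  have hi' : i ≤ k := by simp at hi; omega
  rw [contract, coeffs_ofCoeffs _ hi']
  simp
  ring

theorem sum_choose_mul_choose_sub {n k i N : ℕ} (h : n + k = N) (hi : i ≤ k) :
    ∑ l ∈ range (N + 1), n.choose l * (k - i).choose l = (N - i).choose n := by
  subst h
  have e : n + k - i = (k - i) + n := by omega
  rw [e, Nat.add_choose_eq, Finset.Nat.sum_antidiagonal_eq_sum_range_succ
    (fun u v => (k - i).choose u * n.choose v)]
  symm
  apply Finset.sum_subset_zero_on_sdiff (by intro x; simp; omega)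
  · intro l hl
    have : n < l := by simp at hl; omega
    simp [Nat.choose_eq_zero_of_lt this]
  · intro l hl
    have hl' : l ≤ n := by simp at hl; omega
    rw [Nat.choose_symm hl', mul_comm]

/-- The majorization bound for a pure state, by strong induction on the target degree `k`. The bound
is attained when `χ` is a coherent vector and the `v i` are the first weight vectors counted from
its direction. -/
theorem sum_norm_sq_contract_le (k : ℕ) : ∀ (a N : ℕ), a + k = N → ∀ (χ : SpinSpace a) (m : ℕ)
    (v : Fin m → SpinSpace N), Orthonormal ℂ v →
    ∑ i, ‖contract k χ (v i)‖ ^ 2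
      ≤ ‖χ‖ ^ 2 * ∑ i ∈ range m, ((N - i).choose a : ℝ) / (N.choose a : ℝ) := by
  induction k using Nat.strong_induction_on with
  | _ k ih =>
  intro n N h φ m v hv
  have hN0 : (0 : ℝ) < N.choose n := by exact_mod_cast Nat.choose_pos (by omega)
  set W : Submodule ℂ (SpinSpace k) := Submodule.span ℂ (Set.range fun i => contract k φ (v i))
    with hW
  set b := stdOrthonormalBasis ℂ W with hb
  set m' := Module.finrank ℂ W with hm'
  have hm1 : m' ≤ m := by
    have := finrank_range_le_card (R := ℂ) (fun i => contract k φ (v i))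
    simpa [Set.finrank] using this
  -- Keeps every summation index at most `k`, so that `k - i` below is a true difference.
  have hm2 : m' ≤ k + 1 := by
    have := Submodule.finrank_le W
    simpa using this
  have hbo : Orthonormal ℂ (fun j => (b j : SpinSpace k)) :=
    b.orthonormal.comp_linearIsometry W.subtypeₗᵢ
  -- Duality: expand each contraction in the basis `b` of the span, move `φ` to the other side as a
  -- multiplication, and apply Bessel's inequality to the family `v`.
  have s1 : ∑ i, ‖contract k φ (v i)‖ ^ 2 ≤ ∑ j, ‖formMul N φ (b j : SpinSpace k)‖ ^ 2 := by
    have e : ∀ i, ‖contract k φ (v i)‖ ^ 2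
        = ∑ j, ‖inner ℂ (v i) (formMul N φ (b j : SpinSpace k))‖ ^ 2 := by
      intro i
      have hmem : contract k φ (v i) ∈ W := Submodule.subset_span ⟨i, rfl⟩
      have := b.sum_sq_norm_inner_right ⟨_, hmem⟩
      rw [Submodule.coe_norm] at this
      rw [← this]
      refine sum_congr rfl fun j _ => ?_
      rw [norm_inner_symm (v i), inner_formMul h, Submodule.coe_inner]
    simp_rw [e]
    rw [Finset.sum_comm]
    exact Finset.sum_le_sum fun j _ => hv.sum_inner_products_le _
  refine s1.trans ?_
  have s2 : (N.choose n : ℝ) * ∑ j, ‖formMul N φ (b j : SpinSpace k)‖ ^ 2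
      = ∑ l ∈ range (N + 1), (n.choose l : ℝ) * (k.choose l : ℝ) *
          ∑ c ∈ range (n - l + 1), ∑ j, ‖contract (k - l) (part l c φ) (b j : SpinSpace k)‖ ^ 2 := by
    rw [Finset.mul_sum]
    simp_rw [choose_mul_norm_sq_formMul h]
    rw [Finset.sum_comm]
    refine sum_congr rfl fun l _ => ?_
    rw [← Finset.mul_sum, Finset.sum_comm]
  have s3 : ∀ l ∈ range (N + 1), (n.choose l : ℝ) * (k.choose l : ℝ) *
          ∑ c ∈ range (n - l + 1), ∑ j, ‖contract (k - l) (part l c φ) (b j : SpinSpace k)‖ ^ 2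
      ≤ ‖φ‖ ^ 2 * ∑ i ∈ range m', ((n.choose l * (k - i).choose l : ℕ) : ℝ) := by
    intro l _
    rcases Nat.lt_or_ge n l with hn | hn
    · simp [Nat.choose_eq_zero_of_lt hn]
    rcases Nat.lt_or_ge k l with hk | hk
    · rw [Nat.choose_eq_zero_of_lt hk]
      simp only [Nat.cast_zero, mul_zero, zero_mul]
      positivity
    have hk0 : (0 : ℝ) < k.choose l := by exact_mod_cast Nat.choose_pos hk
    have hc : ∀ c ∈ range (n - l + 1),
        ∑ j, ‖contract (k - l) (part l c φ) (b j : SpinSpace k)‖ ^ 2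
          ≤ ‖part l c φ‖ ^ 2 * ∑ i ∈ range m', ((k - i).choose l : ℝ) / (k.choose l : ℝ) := by
      intro c _
      -- For `l = 0` the contraction is scalar and the bound is an equality. For `l ≥ 1` the
      -- induction hypothesis applies to the target degree `k - l`, with `b` in the role of `v`.
      rcases Nat.eq_zero_or_pos l with rfl | hl0
      · simp only [Nat.sub_zero, norm_sq_contract_zero, hbo.1]
        simp [mul_comm]
      · exact ih (k - l) (by omega) l k (by omega) _ _ _ hbo
    calc _ ≤ (n.choose l : ℝ) * (k.choose l : ℝ) * ∑ c ∈ range (n - l + 1),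
            ‖part l c φ‖ ^ 2 * ∑ i ∈ range m', ((k - i).choose l : ℝ) / (k.choose l : ℝ) := by
          gcongr with c hc'; exact hc c hc'
      _ = _ := by
          rw [← Finset.sum_mul, sum_norm_sq_part hn, ← Finset.sum_div]
          push_cast
          rw [← Finset.mul_sum]
          field_simp
  have s4 : (N.choose n : ℝ) * ∑ j, ‖formMul N φ (b j : SpinSpace k)‖ ^ 2
      ≤ ‖φ‖ ^ 2 * ∑ i ∈ range m', ((N - i).choose n : ℝ) := by
    rw [s2]
    refine (Finset.sum_le_sum s3).trans (le_of_eq ?_)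
    rw [← Finset.mul_sum, Finset.sum_comm]
    congr 1
    refine sum_congr rfl fun i hi => ?_
    have hi' : i ≤ k := by simp at hi; omega
    exact_mod_cast sum_choose_mul_choose_sub h hi'
  rw [← Finset.sum_div, ← mul_div_assoc, le_div_iff₀ hN0, mul_comm]
  refine s4.trans ?_
  -- The summands are nonnegative, so enlarging `m'` to `m` only increases the bound.
  gcongr

end BlochCoherent

end

/-! ### Coherent vectors, the spectrum of the cloned state, and Karamata's inequality. -/

noncomputable section

namespace BlochCoherent

open Finset

/-- The coherent vector `(α, β)^⊗n`. -/
def coherentVec (n : ℕ) (α β : ℂ) : SpinSpace n := ofCoeffs n fun i => α ^ (n - i) * β ^ i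

theorem inner_coherentVec (n : ℕ) (α β α' β' : ℂ) :
    inner ℂ (coherentVec n α β) (coherentVec n α' β')
      = (starRingEnd ℂ α * α' + starRingEnd ℂ β * β') ^ n := by
  rw [inner_eq_sum_coeffs, add_comm (starRingEnd ℂ α * α'), add_pow]
  refine sum_congr rfl fun i hi => ?_
  have hi' : i ≤ n := by simp at hi; omega
  rw [coherentVec, coherentVec, coeffs_ofCoeffs _ hi', coeffs_ofCoeffs _ hi']
  simp only [map_mul, map_pow, mul_pow]
  ring

theorem norm_coherentVec (n : ℕ) {α β : ℂ} (h : Complex.normSq α + Complex.normSq β = 1) :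
    ‖coherentVec n α β‖ = 1 := by
  have h1 := inner_coherentVec n α β α β
  rw [← Complex.normSq_eq_conj_mul_self, ← Complex.normSq_eq_conj_mul_self, ← Complex.ofReal_add,
    h, Complex.ofReal_one, one_pow, inner_self_eq_norm_sq_to_K, RCLike.ofReal_eq_complex_ofReal] at h1
  have h2 : ‖coherentVec n α β‖ ^ 2 = 1 := by exact_mod_cast h1
  nlinarith [norm_nonneg (coherentVec n α β)]

/-- A coherent vector is a tensor power, so contracting `a` factors splits off a scalar. Hence
cloning preserves expectations in coherent states. -/
theorem contract_coherentVec {a k N : ℕ} (h : a + k = N) (χ : SpinSpace a) (α β : ℂ) :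
    contract k χ (coherentVec N α β)
      = inner ℂ χ (coherentVec a α β) • coherentVec k α β := by
  subst h
  ext b
  have hb : (b : ℕ) ≤ k := by omega
  rw [contract, PiLp.smul_apply, inner_eq_sum_coeffs]
  simp only [ofCoeffs, coherentVec, smul_eq_mul]
  rw [mul_left_comm, Finset.sum_mul]
  congr 1
  refine sum_congr rfl fun j hj => ?_
  have hj' : j ≤ a := by simp at hj; omega
  have e := coeffs_ofCoeffs (n := a + k) (i := j + b) (fun i => α ^ (a + k - i) * β ^ i) (by omega)
  have e' := coeffs_ofCoeffs (n := a) (i := j) (fun i => α ^ (a - i) * β ^ i) (by omega)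
  simp only [ofCoeffs] at e e'
  rw [e, e']
  have : a + k - (j + b) = (a - j) + (k - b) := by omega
  rw [this, pow_add, pow_add]
  ring

theorem coeffs_add {n : ℕ} (φ ψ : SpinSpace n) (i : ℕ) :
    coeffs (φ + ψ) i = coeffs φ i + coeffs ψ i := by
  unfold coeffs; split_ifs <;> simp [add_div]

theorem coeffs_smul {n : ℕ} (c : ℂ) (φ : SpinSpace n) (i : ℕ) :
    coeffs (c • φ) i = c * coeffs φ i := by
  unfold coeffs; split_ifs <;> simp [mul_div_assoc]

/-- Contraction with `χ` as a linear map. -/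
def contractLin (k N : ℕ) {a : ℕ} (χ : SpinSpace a) : SpinSpace N →ₗ[ℂ] SpinSpace k where
  toFun := contract k χ
  map_add' u v := by
    ext b
    simp only [contract, ofCoeffs, coeffs_add, PiLp.add_apply]
    rw [← mul_add, ← Finset.sum_add_distrib]
    congr 1
    exact sum_congr rfl fun j _ => by ring
  map_smul' c u := by
    ext b
    simp only [contract, ofCoeffs, coeffs_smul, PiLp.smul_apply, smul_eq_mul, RingHom.id_apply]
    rw [mul_left_comm]
    congr 1
    rw [Finset.mul_sum]
    exact sum_congr rfl fun j _ => by ring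

theorem re_inner_eq_sum_eigenvalues {n : ℕ} {T : SpinSpace n →ₗ[ℂ] SpinSpace n}
    (hT : T.IsSymmetric) (hn : Module.finrank ℂ (SpinSpace n) = n + 1) (v : SpinSpace n) :
    (inner ℂ v (T v)).re
      = ∑ i, hT.eigenvalues hn i * ‖inner ℂ (hT.eigenvectorBasis hn i) v‖ ^ 2 := by
  rw [← (hT.eigenvectorBasis hn).sum_inner_mul_inner v (T v), Complex.re_sum]
  refine sum_congr rfl fun i _ => ?_
  have h := hT.eigenvectorBasis_apply_self_apply hn v i
  rw [OrthonormalBasis.repr_apply_apply, OrthonormalBasis.repr_apply_apply] at h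
  rw [h, mul_left_comm, ← inner_conj_symm v, ← Complex.normSq_eq_conj_mul_self,
    Complex.normSq_eq_norm_sq, RCLike.ofReal_eq_complex_ofReal, ← Complex.ofReal_mul,
    Complex.ofReal_re]

theorem isSymmetric_sum_adjoint_comp {ι E F : Type*} [Fintype ι] [NormedAddCommGroup E]
    [InnerProductSpace ℂ E] [FiniteDimensional ℂ E] [NormedAddCommGroup F]
    [InnerProductSpace ℂ F] [FiniteDimensional ℂ F] (r : ι → ℝ) (C : ι → E →ₗ[ℂ] F) :
    (∑ a, (r a : ℂ) • (LinearMap.adjoint (C a) ∘ₗ C a)).IsSymmetric := by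
  intro x y
  simp only [LinearMap.sum_apply, sum_inner, inner_sum]
  refine sum_congr rfl fun a _ => ?_
  rw [LinearMap.smul_apply, LinearMap.smul_apply, inner_smul_left, inner_smul_right,
    LinearMap.comp_apply, LinearMap.comp_apply, LinearMap.adjoint_inner_left,
    LinearMap.adjoint_inner_right, Complex.conj_ofReal]

/-- The output state of the cloning map, in diagonal form: its spectrum is majorized by the
spectrum for a coherent state, and it has the same lower symbol as `ρ`. -/
theorem exists_majorized_spectrum {n k N : ℕ} (h : n + k = N)
    {ρ : SpinSpace n →ₗ[ℂ] SpinSpace n} (hρ : IsDensity ρ) :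
    ∃ (l : ℕ → ℝ) (u : OrthonormalBasis (Fin (N + 1)) ℂ (SpinSpace N)),
      (∀ i j, i ≤ j → j ≤ N → l j ≤ l i) ∧ (∀ i, i ≤ N → 0 ≤ l i) ∧
      (∀ m, m ≤ N + 1 → ∑ i ∈ range m, l i
        ≤ ∑ i ∈ range m, ((N - i).choose n : ℝ) / (N.choose n : ℝ)) ∧
      ∀ α β : ℂ, Complex.normSq α + Complex.normSq β = 1 →
        (inner ℂ (coherentVec n α β) (ρ (coherentVec n α β))).re
          = ∑ i : Fin (N + 1), l i * ‖inner ℂ (u i) (coherentVec N α β)‖ ^ 2 := by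
  have hn : Module.finrank ℂ (SpinSpace n) = n + 1 := by simp
  have hN : Module.finrank ℂ (SpinSpace N) = N + 1 := by simp
  have hs := hρ.1.isSymmetric
  set r := hs.eigenvalues hn with hr
  set φ := hs.eigenvectorBasis hn with hφ
  have hr0 : ∀ a, 0 ≤ r a := fun a => hρ.1.nonneg_eigenvalues hn a
  have hr1 : ∑ a, r a = 1 := by
    have := hs.trace_eq_sum_eigenvalues hn
    rw [hρ.2, RCLike.ofReal_eq_complex_ofReal] at this
    exact_mod_cast this.symm
  set C : Fin (n + 1) → SpinSpace N →ₗ[ℂ] SpinSpace k := fun a => contractLin k N (φ a) with hC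
  -- The compression of `ρ ⊗ 1` to `Sym^N`, written with the spectral decomposition of `ρ`.
  set T : SpinSpace N →ₗ[ℂ] SpinSpace N :=
    ∑ a, (r a : ℂ) • (LinearMap.adjoint (C a) ∘ₗ C a) with hT
  have hTs : T.IsSymmetric := isSymmetric_sum_adjoint_comp r C
  have hTq : ∀ v, (inner ℂ v (T v)).re = ∑ a, r a * ‖contract k (φ a) v‖ ^ 2 := by
    intro v
    simp only [hT, LinearMap.sum_apply, inner_sum, Complex.re_sum]
    refine sum_congr rfl fun a _ => ?_
    rw [LinearMap.smul_apply, inner_smul_right, LinearMap.comp_apply,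
      LinearMap.adjoint_inner_right, inner_self_eq_norm_sq_to_K, RCLike.ofReal_eq_complex_ofReal]
    rw [← Complex.ofReal_pow, ← Complex.ofReal_mul, Complex.ofReal_re]
    rfl
  set u := hTs.eigenvectorBasis hN with hu
  have hl : ∀ i, hTs.eigenvalues hN i = ∑ a, r a * ‖contract k (φ a) (u i)‖ ^ 2 := by
    intro i
    rw [← hTq, hu, hTs.apply_eigenvectorBasis, inner_smul_right, inner_self_eq_norm_sq_to_K,
      (hTs.eigenvectorBasis hN).orthonormal.1]
    simp
  refine ⟨fun i => if hi : i < N + 1 then hTs.eigenvalues hN ⟨i, hi⟩ else 0, u, ?_, ?_, ?_, ?_⟩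
  · intro i j hij hj
    simp only
    rw [dif_pos (by omega), dif_pos (by omega)]
    exact hTs.eigenvalues_antitone hN hij
  · intro i hi
    simp only
    rw [dif_pos (by omega), hl]
    exact Finset.sum_nonneg fun a _ => mul_nonneg (hr0 a) (by positivity)
  · intro m hm
    rw [Finset.sum_range]
    have e : ∀ i : Fin m, (if hi : (i : ℕ) < N + 1 then hTs.eigenvalues hN ⟨i, hi⟩ else 0)
        = ∑ a, r a * ‖contract k (φ a) (u (Fin.castLE hm i))‖ ^ 2 := by
      intro i
      rw [dif_pos (by omega), hl]
      rfl
    simp only [e]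
    rw [Finset.sum_comm]
    have hle : ∀ a, ∑ i : Fin m, r a * ‖contract k (φ a) (u (Fin.castLE hm i))‖ ^ 2
        ≤ r a * ∑ i ∈ range m, ((N - i).choose n : ℝ) / (N.choose n : ℝ) := by
      intro a
      rw [← Finset.mul_sum]
      refine mul_le_mul_of_nonneg_left ?_ (hr0 a)
      have := sum_norm_sq_contract_le k n N h (φ a) m (fun i => u (Fin.castLE hm i))
        (u.orthonormal.comp _ (Fin.castLE_injective hm))
      rwa [φ.orthonormal.1, one_pow, one_mul] at this
    refine (Finset.sum_le_sum fun a _ => hle a).trans (le_of_eq ?_)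
    rw [← Finset.sum_mul, hr1, one_mul]
  · intro α β hαβ
    have e : ∀ i : Fin (N + 1), (if hi : (i : ℕ) < N + 1 then hTs.eigenvalues hN ⟨i, hi⟩ else 0)
        = hTs.eigenvalues hN i := fun i => dif_pos i.2
    simp only [e]
    rw [← re_inner_eq_sum_eigenvalues hTs hN, hTq, re_inner_eq_sum_eigenvalues hs hn]
    refine sum_congr rfl fun a _ => ?_
    rw [contract_coherentVec h, norm_smul, norm_coherentVec k hαβ, mul_one]

/-- Chord slopes of a concave function decrease when both endpoints move right. The endpoints are
moved one at a time, through the chord between `b` and `c` when that is not degenerate. -/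
theorem _root_.ConcaveOn.slope_le_slope {f : ℝ → ℝ} {s : Set ℝ} (hf : ConcaveOn ℝ s f)
    {a b c d : ℝ} (ha : a ∈ s) (hb : b ∈ s) (hc : c ∈ s) (hd : d ∈ s) (hab : a ≠ b) (hcd : c ≠ d)
    (hca : c ≤ a) (hdb : d ≤ b) : slope f b a ≤ slope f d c := by
  by_cases hbc : c = b
  · subst hbc
    rw [slope_comm f d]
    exact hf.slope_anti hc ⟨hd, hcd.symm⟩ ⟨ha, hab⟩ (hdb.trans hca)
  · refine (hf.slope_anti hb ⟨hc, hbc⟩ ⟨ha, hab⟩ hca).trans ?_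
    rw [slope_comm, slope_comm f d]
    exact hf.slope_anti hc ⟨hd, hcd.symm⟩ ⟨hb, fun h => hbc h.symm⟩ hdb

/-- Karamata's inequality for concave functions. -/
theorem sum_le_sum_of_majorized {f : ℝ → ℝ} {s : Set ℝ} (hf : ConcaveOn ℝ s f) {N : ℕ}
    {l μ : ℕ → ℝ} (hls : ∀ i < N, l i ∈ s) (hμs : ∀ i < N, μ i ∈ s)
    (hl : ∀ i j, i ≤ j → j < N → l j ≤ l i) (hμ : ∀ i j, i ≤ j → j < N → μ j ≤ μ i)
    (hle : ∀ m ≤ N, ∑ i ∈ range m, l i ≤ ∑ i ∈ range m, μ i)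
    (heq : ∑ i ∈ range N, l i = ∑ i ∈ range N, μ i) :
    ∑ i ∈ range N, f (μ i) ≤ ∑ i ∈ range N, f (l i) := by
  -- Abel summation by induction. The chord slopes from `μ j` to `l j` grow with `j` while the
  -- partial sums of `l - μ` are nonpositive, so replacing the slopes by a common upper bound `c`
  -- lowers the total. Indices with `l j = μ j` have no chord and contribute nothing.
  have key : ∀ m ≤ N, ∀ c : ℝ, (∀ j < m, l j ≠ μ j → slope f (μ j) (l j) ≤ c) →
      c * (∑ i ∈ range m, l i - ∑ i ∈ range m, μ i)
        ≤ ∑ i ∈ range m, f (l i) - ∑ i ∈ range m, f (μ i) := by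
    intro m
    induction m with
    | zero => intro _ c _; simp
    | succ m ih =>
      intro hm c hc
      have hD := hle (m + 1) hm
      rw [Finset.sum_range_succ, Finset.sum_range_succ] at hD ⊢
      rw [Finset.sum_range_succ, Finset.sum_range_succ]
      by_cases hne : l m = μ m
      · have := ih (by omega) c (fun j hj => hc j (by omega))
        rw [hne]
        linarith
      · have hsl : ∀ j < m, l j ≠ μ j → slope f (μ j) (l j) ≤ slope f (μ m) (l m) := by
          intro j hj hjne
          have h1 := hl j m hj.le (by omega)
          have h2 := hμ j m hj.le (by omega)
          exact hf.slope_le_slope (hls j (by omega)) (hμs j (by omega)) (hls m (by omega))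
            (hμs m (by omega)) hjne hne h1 h2
        have h1 := ih (by omega) _ hsl
        have h2 := hc m (by omega) hne
        have h3 : slope f (μ m) (l m) * (l m - μ m) = f (l m) - f (μ m) := by
          rw [slope_def_field]
          field_simp [sub_ne_zero.mpr hne]
        nlinarith
  rcases Nat.eq_zero_or_pos N with rfl | hN
  · simp
  obtain ⟨c, hc⟩ : ∃ c : ℝ, ∀ j < N, slope f (μ j) (l j) ≤ c := by
    refine ⟨(range N).sup' ⟨0, by simpa using hN⟩ fun j => slope f (μ j) (l j), fun j hj => ?_⟩
    exact Finset.le_sup' (fun j => slope f (μ j) (l j)) (by simpa using hj)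
  have := key N le_rfl c (fun j hj _ => hc j hj)
  rw [heq] at this
  linarith

end BlochCoherent

end

/-! ### The top eigenspace of the spin operator, and lower symbols through spinors. -/

noncomputable section

namespace BlochCoherent

open Finset

/-- `(α, β)` is a unit spinor pointing in the direction `ω`. -/
structure IsSpinor (ω : S2) (α β : ℂ) : Prop where
  add_eq : Complex.normSq α + Complex.normSq β = 1
  sub_eq : Complex.normSq α - Complex.normSq β = ω.1 2
  mul_eq : 2 * starRingEnd ℂ α * β = (ω.1 0 : ℂ) + (ω.1 1 : ℂ) * Complex.I

theorem sq_add_sq_add_sq (ω : S2) : ω.1 0 ^ 2 + ω.1 1 ^ 2 + ω.1 2 ^ 2 = 1 := by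
  have h : ‖ω.1‖ = 1 := by simp
  have h2 := EuclideanSpace.norm_sq_eq ω.1
  rw [h, Fin.sum_univ_three] at h2
  simpa using h2.symm

/-- The first component of a spinor in the direction `ω`. -/
def spinorA (ω : S2) : ℂ := if ω.1 2 = -1 then 0 else (√((1 + ω.1 2) / 2) : ℝ)

/-- The second component of a spinor in the direction `ω`. -/
def spinorB (ω : S2) : ℂ :=
  if ω.1 2 = -1 then 1
  else ((ω.1 0 : ℂ) + (ω.1 1 : ℂ) * Complex.I) / (2 * (√((1 + ω.1 2) / 2) : ℝ))

/-- The Hopf map has no continuous section. Choosing the phase so that `α ≥ 0`, with the south pole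
set apart, gives a measurable one, which suffices. -/
theorem isSpinor_spinor (ω : S2) : IsSpinor ω (spinorA ω) (spinorB ω) := by
  have h := sq_add_sq_add_sq ω
  by_cases hz : ω.1 2 = -1
  · have h0 : ω.1 0 = 0 := by rw [hz] at h; nlinarith
    have h1 : ω.1 1 = 0 := by rw [hz] at h; nlinarith
    constructor <;> simp [spinorA, spinorB, hz, h0, h1]
  · have hz' : 0 < 1 + ω.1 2 := by
      have : -1 ≤ ω.1 2 := by nlinarith
      have := lt_of_le_of_ne this (Ne.symm hz)
      linarith
    set s := √((1 + ω.1 2) / 2) with hs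
    have hs0 : 0 < s := Real.sqrt_pos.mpr (by linarith)
    have hs2 : s * s = (1 + ω.1 2) / 2 := Real.mul_self_sqrt (by linarith)
    have hA : Complex.normSq (spinorA ω) = (1 + ω.1 2) / 2 := by
      rw [spinorA, if_neg hz, Complex.normSq_ofReal, hs2]
    have hB : Complex.normSq (spinorB ω) = (1 - ω.1 2) / 2 := by
      rw [spinorB, if_neg hz, map_div₀, map_mul, Complex.normSq_ofReal, hs2,
        Complex.normSq_add_mul_I, Complex.normSq_ofNat, div_eq_iff (by positivity)]
      nlinarith
    refine ⟨by rw [hA, hB]; ring, by rw [hA, hB]; ring, ?_⟩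
    rw [spinorA, spinorB, if_neg hz, if_neg hz, Complex.conj_ofReal]
    have : ((s : ℝ) : ℂ) ≠ 0 := by exact_mod_cast hs0.ne'
    rw [← hs]
    field_simp

theorem measurable_spinorA : Measurable spinorA := by
  have hc : ∀ i, Measurable fun ω : S2 => ω.1 i := fun i => by fun_prop
  refine Measurable.ite (measurableSet_eq_fun (hc 2) measurable_const) measurable_const ?_
  have := hc 2
  fun_prop

theorem measurable_spinorB : Measurable spinorB := by
  have hc : ∀ i, Measurable fun ω : S2 => ω.1 i := fun i => by fun_prop
  refine Measurable.ite (measurableSet_eq_fun (hc 2) measurable_const) measurable_const ?_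
  have h0 := hc 0
  have h1 := hc 1
  have h2 := hc 2
  fun_prop

/-- On binary forms `S₊` acts as `X ∂_Y`; the square roots come from the normalization of the weight
vectors. -/
theorem sum_raising {n : ℕ} (ψ : SpinSpace n) (i : Fin (n + 1)) :
    ∑ j, raising n i j * ψ j
      = (√(n.choose i : ℝ) : ℂ) * (((n : ℂ) - (i : ℕ)) * coeffs ψ (i + 1)) := by
  by_cases hi : (i : ℕ) + 1 < n + 1
  · rw [Finset.sum_eq_single ⟨(i : ℕ) + 1, hi⟩]
    · rw [apply_eq_coeffs]
      simp only [raising, Matrix.of_apply, if_true]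
      rw [← mul_assoc, ← mul_assoc]
      congr 1
      have hle : (i : ℕ) ≤ n := by omega
      have h := congrArg (Nat.cast (R := ℝ)) (Nat.choose_succ_right_eq n i)
      push_cast [Nat.cast_sub hle] at h
      have hle' : (0 : ℝ) ≤ n - (i : ℕ) := by
        have : ((i : ℕ) : ℝ) ≤ n := by exact_mod_cast hle
        linarith
      rw [← Complex.ofReal_mul, ← Real.sqrt_mul' _ (by positivity)]
      push_cast
      have e : ((i : ℕ) + 1 : ℝ) * (n + 1 - ((i : ℕ) + 1)) * (n.choose (i + 1))
          = (n.choose i) * (n - (i : ℕ)) ^ 2 := by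
        linear_combination (n - (i : ℕ) : ℝ) * h
      rw [e, Real.sqrt_mul (by positivity), Real.sqrt_sq hle']
      push_cast
      ring
    · intro j _ hj
      have : (i : ℕ) + 1 ≠ j := fun h => hj (Fin.ext h.symm)
      simp [raising, this]
    · simp
  · have hin : (i : ℕ) = n := by omega
    rw [coeffs_eq_zero ψ (by omega), mul_zero, mul_zero]
    refine Finset.sum_eq_zero fun j _ => ?_
    have : (i : ℕ) + 1 ≠ j := by omega
    simp [raising, this]

/-- On binary forms `S₊*` acts as `Y ∂_X`. At `i = 0` the truncated index `i - 1` is harmless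
because of the factor `i`. -/
theorem sum_raising_conjTranspose {n : ℕ} (ψ : SpinSpace n) (i : Fin (n + 1)) :
    ∑ j, (raising n).conjTranspose i j * ψ j
      = (√(n.choose i : ℝ) : ℂ) * (((i : ℕ) : ℂ) * coeffs ψ (i - 1)) := by
  by_cases hi : (i : ℕ) = 0
  · rw [hi]
    simp only [Nat.cast_zero, zero_mul, mul_zero]
    refine Finset.sum_eq_zero fun j _ => ?_
    have : (j : ℕ) + 1 ≠ i := by omega
    simp [raising, Matrix.conjTranspose_apply, this]
  · obtain ⟨t, ht⟩ := Nat.exists_eq_succ_of_ne_zero hi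
    rw [Finset.sum_eq_single ⟨t, by omega⟩]
    · rw [apply_eq_coeffs]
      simp only [raising, Matrix.conjTranspose_apply, Matrix.of_apply]
      rw [if_pos (by omega), ht, Nat.succ_eq_add_one, Nat.add_sub_cancel, ← mul_assoc, ← mul_assoc]
      congr 1
      have hle : t ≤ n := by omega
      have h := congrArg (Nat.cast (R := ℝ)) (Nat.choose_succ_right_eq n t)
      push_cast [Nat.cast_sub hle] at h
      rw [RCLike.star_def, Complex.conj_ofReal, ← Complex.ofReal_mul,
        ← Real.sqrt_mul' _ (by positivity)]
      push_cast
      have e : ((t : ℝ) + 1) * (n + 1 - (t + 1)) * (n.choose t)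
          = (n.choose (t + 1)) * (t + 1) ^ 2 := by
        linear_combination (-(t + 1) : ℝ) * h
      rw [e, Real.sqrt_mul (by positivity), Real.sqrt_sq (by positivity)]
      push_cast
      ring
    · intro j _ hj
      have : (j : ℕ) + 1 ≠ i := fun h => hj (Fin.ext (by simp; omega))
      simp [raising, Matrix.conjTranspose_apply, this]
    · simp

/-- Both brackets on the right are defects of the recursion `α x_{i+1} = β x_i` that characterizes
multiples of a coherent vector. -/
theorem spinDot_apply {n : ℕ} {ω : S2} {α β : ℂ} (h : IsSpinor ω α β) (ψ : SpinSpace n)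
    (i : Fin (n + 1)) :
    (spinDot n ω ψ) i - (n : ℂ) / 2 * ψ i = (√(n.choose i : ℝ) : ℂ) *
      (((n : ℂ) - (i : ℕ)) * starRingEnd ℂ β * (α * coeffs ψ (i + 1) - β * coeffs ψ i)
        + ((i : ℕ) : ℂ) * starRingEnd ℂ α * (β * coeffs ψ (i - 1) - α * coeffs ψ i)) := by
  have e : (spinDot n ω ψ) i
      = ((ω.1 0 : ℂ) - (ω.1 1 : ℂ) * Complex.I) / 2 * ∑ j, raising n i j * ψ j
        + ((ω.1 0 : ℂ) + (ω.1 1 : ℂ) * Complex.I) / 2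
          * ∑ j, (raising n).conjTranspose i j * ψ j
        + (ω.1 2 : ℂ) * (((n : ℂ) / 2 - (i : ℕ)) * ψ i) := by
    have hz : ((n : ℂ) / 2 - (i : ℕ)) * ψ i = ∑ j, spinZ n i j * ψ j := by
      rw [Finset.sum_eq_single i]
      · simp [spinZ]
      · intro j _ hj; simp [spinZ, Matrix.diagonal_apply_ne _ hj.symm]
      · simp
    rw [hz, spinDot, Matrix.toLpLin_apply, Finset.mul_sum, Finset.mul_sum, Finset.mul_sum,
      ← Finset.sum_add_distrib, ← Finset.sum_add_distrib]
    simp only [Matrix.mulVec, dotProduct]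
    refine sum_congr rfl fun j _ => ?_
    simp only [spinX, spinY, Matrix.add_apply, Matrix.smul_apply, Matrix.sub_apply, smul_eq_mul,
      one_div, mul_inv, Complex.inv_I]
    ring
  have hm := h.mul_eq
  have hm' := congrArg (starRingEnd ℂ) hm
  simp only [map_mul, map_add, Complex.conj_conj, Complex.conj_ofReal, Complex.conj_I,
    Complex.conj_ofNat] at hm'
  have ha : starRingEnd ℂ α * α + starRingEnd ℂ β * β = 1 := by
    rw [← Complex.normSq_eq_conj_mul_self, ← Complex.normSq_eq_conj_mul_self]
    exact_mod_cast h.add_eq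
  have hs : starRingEnd ℂ α * α - starRingEnd ℂ β * β = (ω.1 2 : ℂ) := by
    rw [← Complex.normSq_eq_conj_mul_self, ← Complex.normSq_eq_conj_mul_self]
    exact_mod_cast h.sub_eq
  have e2 : (ω.1 0 : ℂ) - (ω.1 1 : ℂ) * Complex.I = 2 * α * starRingEnd ℂ β := by
    rw [hm']; ring
  rw [e, sum_raising, sum_raising_conjTranspose, e2, ← hm, ← hs, apply_eq_coeffs ψ i]
  linear_combination ((n : ℂ) / 2 * ((√(n.choose i : ℝ) : ℂ) * coeffs ψ i)) * ha

theorem eigenspace_spinDot {n : ℕ} {ω : S2} {α β : ℂ} (h : IsSpinor ω α β) :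
    Module.End.eigenspace (spinDot n ω) ((n : ℂ) / 2)
      = Submodule.span ℂ {coherentVec n α β} := by
  have mem_iff : ∀ ψ : SpinSpace n, ψ ∈ Module.End.eigenspace (spinDot n ω) ((n : ℂ) / 2) ↔
      ∀ i, i ≤ n → ((n : ℂ) - i) * starRingEnd ℂ β * (α * coeffs ψ (i + 1) - β * coeffs ψ i)
        + (i : ℂ) * starRingEnd ℂ α * (β * coeffs ψ (i - 1) - α * coeffs ψ i) = 0 := by
    intro ψ
    rw [Module.End.mem_eigenspace_iff]
    constructor
    · intro hψ i hi
      have := spinDot_apply h ψ ⟨i, by omega⟩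
      rw [hψ, PiLp.smul_apply, smul_eq_mul, sub_self] at this
      exact (mul_eq_zero.mp this.symm).resolve_left (sqrt_choose_ne_zero hi)
    · intro hψ
      ext i
      have := spinDot_apply h ψ i
      rw [hψ i (by omega), mul_zero, sub_eq_zero] at this
      rw [this, PiLp.smul_apply, smul_eq_mul]
  apply le_antisymm
  · intro ψ hψ
    rw [mem_iff] at hψ
    rw [Submodule.mem_span_singleton]
    suffices H : ∃ c : ℂ, ∀ i ≤ n, coeffs ψ i = c * (α ^ (n - i) * β ^ i) by
      obtain ⟨c, hc⟩ := H
      refine ⟨c, ?_⟩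
      ext i
      rw [apply_eq_coeffs ψ, hc i (by omega)]
      simp only [coherentVec, ofCoeffs, PiLp.smul_apply, smul_eq_mul]
      ring
    by_cases hβ : β = 0
    · subst hβ
      have hα : α ≠ 0 := by
        rintro rfl
        simpa using h.add_eq
      refine ⟨coeffs ψ 0 / α ^ n, fun i hi => ?_⟩
      rcases Nat.eq_zero_or_pos i with rfl | hi0
      · field_simp; simp
      · have := hψ i hi
        simp only [map_zero, mul_zero, zero_mul, zero_add, zero_sub] at this
        have hi' : (i : ℂ) ≠ 0 := by exact_mod_cast hi0.ne'
        rw [zero_pow hi0.ne', mul_zero, mul_zero]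
        simpa [hα, hi'] using this
    · have hβ' : starRingEnd ℂ β ≠ 0 := by simpa using hβ
      -- At `i = 0` only the first bracket of the eigenvalue equation is present. After that, each
      -- second bracket vanishes by the preceding step.
      have hd : ∀ i, i < n → α * coeffs ψ (i + 1) - β * coeffs ψ i = 0 := by
        intro i
        induction i with
        | zero =>
          intro hi
          have := hψ 0 (by omega)
          have hn : (n : ℂ) ≠ 0 := by exact_mod_cast hi.ne'
          simpa [hn, hβ'] using this
        | succ i ih =>
          intro hi
          have := hψ (i + 1) (by omega)
          have hi' := ih (by omega)
          have e : β * coeffs ψ (i + 1 - 1) - α * coeffs ψ (i + 1) = 0 := by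
            rw [Nat.add_sub_cancel]; linear_combination -hi'
          rw [e, mul_zero, add_zero] at this
          have hn : (n : ℂ) - ((i + 1 : ℕ) : ℂ) ≠ 0 := by
            rw [sub_ne_zero]; exact_mod_cast hi.ne'
          exact (mul_eq_zero.mp this).resolve_left (mul_ne_zero hn hβ')
      -- The recursion is solved downward from the last coefficient, since `α` may vanish while `β`
      -- does not.
      refine ⟨coeffs ψ n / β ^ n, ?_⟩
      have hdown : ∀ t, t ≤ n → coeffs ψ (n - t) = coeffs ψ n / β ^ n * (α ^ t * β ^ (n - t)) := by
        intro t
        induction t with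
        | zero => intro _; simp; field_simp
        | succ t ih =>
          intro ht
          have h1 := hd (n - (t + 1)) (by omega)
          have e : n - (t + 1) + 1 = n - t := by omega
          rw [e, ih (by omega)] at h1
          have e2 : n - t = n - (t + 1) + 1 := by omega
          rw [e2, pow_succ] at h1
          apply mul_left_cancel₀ hβ
          linear_combination -h1
      intro i hi
      have := hdown (n - i) (by omega)
      rwa [Nat.sub_sub_self hi] at this
  · rw [Submodule.span_le, Set.singleton_subset_iff, SetLike.mem_coe, mem_iff]
    have hc : ∀ i, i ≤ n → coeffs (coherentVec n α β) i = α ^ (n - i) * β ^ i :=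
      fun i hi => coeffs_ofCoeffs _ hi
    have hd : ∀ i, i < n →
        α * coeffs (coherentVec n α β) (i + 1) - β * coeffs (coherentVec n α β) i = 0 := by
      intro i hi
      rw [hc _ (by omega), hc _ (by omega)]
      have e : n - i = n - (i + 1) + 1 := by omega
      rw [e, pow_succ]; ring
    intro i hi
    have h1 : ((n : ℂ) - i) * starRingEnd ℂ β * (α * coeffs (coherentVec n α β) (i + 1)
        - β * coeffs (coherentVec n α β) i) = 0 := by
      rcases Nat.lt_or_ge i n with hlt | hge
      · rw [hd i hlt, mul_zero]
      · have : i = n := by omega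
        simp [this]
    have h2 : (i : ℂ) * starRingEnd ℂ α * (β * coeffs (coherentVec n α β) (i - 1)
        - α * coeffs (coherentVec n α β) i) = 0 := by
      rcases Nat.eq_zero_or_pos i with rfl | hpos
      · simp
      · have := hd (i - 1) (by omega)
        rw [Nat.sub_add_cancel hpos] at this
        have e : β * coeffs (coherentVec n α β) (i - 1) - α * coeffs (coherentVec n α β) i = 0 := by
          linear_combination -this
        rw [e, mul_zero]
    rw [h1, h2, add_zero]

theorem coherentProj_apply {n : ℕ} {ω : S2} {α β : ℂ} (h : IsSpinor ω α β) (ψ : SpinSpace n) :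
    coherentProj n ω ψ = inner ℂ (coherentVec n α β) ψ • coherentVec n α β := by
  rw [coherentProj]
  simp only [eigenspace_spinDot h]
  exact Submodule.starProjection_unit_singleton ℂ (norm_coherentVec n h.add_eq) ψ

theorem lowerSymbol_eq {n : ℕ} (ρ : SpinSpace n →ₗ[ℂ] SpinSpace n) {ω : S2} {α β : ℂ}
    (h : IsSpinor ω α β) :
    lowerSymbol ρ ω = (inner ℂ (coherentVec n α β) (ρ (coherentVec n α β))).re := by
  have e : ρ ∘ₗ coherentProj n ω = (InnerProductSpace.rankOne ℂ (ρ (coherentVec n α β))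
      (coherentVec n α β)).toLinearMap := by
    refine LinearMap.ext fun ψ => ?_
    rw [LinearMap.comp_apply, coherentProj_apply h]; simp
  rw [lowerSymbol, LinearMap.trace_comp_comm', e, InnerProductSpace.trace_rankOne]

/-- The squared overlap of two unit spinors is `(1 + ω·ω₀)/2`, and coherent vectors are `n`-th
tensor powers. -/
theorem lowerSymbol_coherentProj {n : ℕ} (ω₀ ω : S2) :
    lowerSymbol (coherentProj n ω₀) ω = ((1 + inner ℝ ω.1 ω₀.1) / 2) ^ n := by
  obtain ⟨a, b, h⟩ : ∃ a b, IsSpinor ω a b := ⟨_, _, isSpinor_spinor ω⟩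
  obtain ⟨c, d, h₀⟩ : ∃ c d, IsSpinor ω₀ c d := ⟨_, _, isSpinor_spinor ω₀⟩
  have key : starRingEnd ℂ (starRingEnd ℂ a * c + starRingEnd ℂ b * d)
      * (starRingEnd ℂ a * c + starRingEnd ℂ b * d) = (((1 + inner ℝ ω.1 ω₀.1) / 2 : ℝ) : ℂ) := by
    have hi : inner ℝ ω.1 ω₀.1
        = ω.1 0 * ω₀.1 0 + ω.1 1 * ω₀.1 1 + ω.1 2 * ω₀.1 2 := by
      rw [PiLp.inner_apply, Fin.sum_univ_three]; simp; ring
    have hm := h.mul_eq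
    have hm₀ := h₀.mul_eq
    have h1 : ω.1 0 = (2 * starRingEnd ℂ a * b).re := by rw [hm]; simp
    have h2 : ω.1 1 = (2 * starRingEnd ℂ a * b).im := by rw [hm]; simp
    have h3 : ω₀.1 0 = (2 * starRingEnd ℂ c * d).re := by rw [hm₀]; simp
    have h4 : ω₀.1 1 = (2 * starRingEnd ℂ c * d).im := by rw [hm₀]; simp
    have s1 := h.add_eq
    have s2 := h₀.add_eq
    rw [← Complex.normSq_eq_conj_mul_self, hi, h1, h2, h3, h4, ← h.sub_eq, ← h₀.sub_eq]
    congr 1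
    simp only [Complex.normSq_apply, Complex.add_re, Complex.add_im, Complex.mul_re,
      Complex.mul_im, Complex.conj_re, Complex.conj_im, Complex.re_ofNat, Complex.im_ofNat] at s1 s2 ⊢
    have s12 : (a.re * a.re + a.im * a.im + (b.re * b.re + b.im * b.im))
      * (c.re * c.re + c.im * c.im + (d.re * d.re + d.im * d.im)) = 1 := by rw [s1, s2, one_mul]
    linear_combination (1 / 2 : ℝ) * s12
  rw [lowerSymbol_eq _ h, coherentProj_apply h₀, inner_smul_right, ← inner_conj_symm,
    inner_coherentVec, map_pow, ← mul_pow, key, ← Complex.ofReal_pow, Complex.ofReal_re]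

end BlochCoherent

end

/-! ### The surface measure in spherical coordinates. -/

noncomputable section

namespace BlochCoherent

open MeasureTheory Set Real
open scoped Pointwise ENNReal

/-- The point of the sphere with polar angle `θ` and azimuth `φ`. -/
def spherePoint (θ φ : ℝ) : S2 :=
  ⟨!₂[sin θ * cos φ, sin θ * sin φ, cos θ], by
    have h : (sin θ * cos φ) ^ 2 + (sin θ * sin φ) ^ 2 + cos θ ^ 2 = 1 := by
      linear_combination sin θ ^ 2 * sin_sq_add_cos_sq φ + sin_sq_add_cos_sq θ
    simp [EuclideanSpace.norm_eq, Fin.sum_univ_three, h]⟩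

theorem continuous_spherePoint : Continuous fun p : ℝ × ℝ => spherePoint p.1 p.2 := by
  refine Continuous.subtype_mk ?_ _
  refine (PiLp.continuous_toLp 2 _).comp (continuous_pi fun i => ?_)
  fin_cases i <;> simp <;> fun_prop

/-- Assembling a vector from its last coordinate and the first two. -/
def cylEquiv (p : ℝ × ℝ × ℝ) : R3 := !₂[p.2.1, p.2.2, p.1]

theorem measurePreserving_cylEquiv : MeasurePreserving cylEquiv := by
  have h1 := EuclideanSpace.volume_preserving_symm_measurableEquiv_toLp (Fin 3)
  have h2 := (volume_preserving_piFinSuccAbove (fun _ : Fin 3 => ℝ) 2).symm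
  have h3 := (MeasurePreserving.id (volume : Measure ℝ)).prod (volume_preserving_finTwoArrow ℝ).symm
  have h4 := h1.symm.comp (h2.comp h3)
  have e : cylEquiv = (MeasurableEquiv.toLp 2 (Fin 3 → ℝ)).symm.symm ∘
      (MeasurableEquiv.piFinSuccAbove (fun _ => ℝ) 2).symm ∘
        Prod.map id MeasurableEquiv.finTwoArrow.symm := by
    ext p i
    fin_cases i <;> rfl
  rw [e]
  exact h4

theorem smul_spherePoint_mem_cone {s : Set S2} {r θ φ : ℝ} (hr : 0 < r) :
    r • (spherePoint θ φ).1 ∈ (Ioo (0 : ℝ) 1 • (Subtype.val '' s) : Set R3)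
      ↔ r < 1 ∧ spherePoint θ φ ∈ s := by
  constructor
  · rintro ⟨t, ht, _, ⟨y, hy, rfl⟩, h⟩
    have h' : t • y.1 = r • (spherePoint θ φ).1 := h
    have hn := congrArg norm h'
    rw [norm_smul, norm_smul, norm_eq_of_mem_sphere, norm_eq_of_mem_sphere, mul_one, mul_one,
      Real.norm_of_nonneg ht.1.le, Real.norm_of_nonneg hr.le] at hn
    subst hn
    have : y = spherePoint θ φ := Subtype.ext (smul_right_injective _ ht.1.ne' h')
    exact ⟨ht.2, this ▸ hy⟩
  · rintro ⟨h1, h2⟩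
    exact ⟨r, ⟨hr, h1⟩, _, ⟨_, h2, rfl⟩, rfl⟩

theorem measurableSet_cone {s : Set S2} (hs : MeasurableSet s) :
    MeasurableSet (Ioo (0 : ℝ) 1 • (Subtype.val '' s) : Set R3) := by
  have e : (Ioo (0 : ℝ) 1 • (Subtype.val '' s) : Set R3)
      = (Subtype.val '' (homeomorphUnitSphereProd R3 ⁻¹' s ×ˢ Iio ⟨1, mem_Ioi.2 one_pos⟩)) := by
    rw [← image2_smul, image2_image_right, ← Homeomorph.image_symm, image_image,
      show Ioo (0 : ℝ) 1 = Subtype.val '' (Iio (⟨1, mem_Ioi.2 one_pos⟩ : Ioi (0 : ℝ))) from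
        (image_subtype_val_Ioi_Iio (⟨1, mem_Ioi.2 one_pos⟩ : Ioi (0 : ℝ))).symm, image2_image_left, image2_swap, ← image_prod]
    rfl
  rw [e]
  exact (MeasurableEmbedding.subtype_coe (measurableSet_singleton _).compl).measurableSet_image.mpr
    ((homeomorphUnitSphereProd R3).measurable (hs.prod measurableSet_Iio))

theorem setLIntegral_polarCoord_target (F : ℝ × ℝ → ℝ≥0∞) (hF : Measurable F) :
    ∫⁻ p in polarCoord.target, F p = ∫⁻ r in Ioi 0, ∫⁻ θ in Ioo (-π) π, F (r, θ) := by
  rw [polarCoord_target, Measure.volume_eq_prod, ← Measure.prod_restrict,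
    lintegral_prod _ hF.aemeasurable]

/-- Polar coordinates twice: in the `(x, y)` plane with radius `s`, then in the `(z, s)` plane. The
restriction `s > 0` becomes `θ ∈ (0, π)`, and the Jacobians multiply to `r² sin θ`. -/
theorem lintegral_R3_eq (G : R3 → ℝ≥0∞) (hG : Measurable G) :
    ∫⁻ x, G x = ∫⁻ r in Ioi 0, ∫⁻ θ in Ioo 0 π, ∫⁻ φ in Ioo (-π) π,
      ENNReal.ofReal (r ^ 2) * (ENNReal.ofReal (sin θ) * G (r • (spherePoint θ φ).1)) := by
  have hc : Measurable cylEquiv := measurePreserving_cylEquiv.measurable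
  rw [← measurePreserving_cylEquiv.lintegral_comp hG, Measure.volume_eq_prod,
    lintegral_prod (fun a => G (cylEquiv a)) (hG.comp hc).aemeasurable]
  have h1 : ∀ z : ℝ, ∫⁻ p : ℝ × ℝ, G (cylEquiv (z, p))
      = ∫⁻ s, (Ioi (0 : ℝ)).indicator (fun s => ∫⁻ φ in Ioo (-π) π,
          ENNReal.ofReal s * G (cylEquiv (z, s * cos φ, s * sin φ))) s := by
    intro z
    rw [← lintegral_comp_polarCoord_symm, setLIntegral_polarCoord_target,
      lintegral_indicator measurableSet_Ioi]
    · simp [polarCoord_symm_apply]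
    · refine Measurable.mul (by fun_prop) ?_
      exact hG.comp (hc.comp (measurable_const.prodMk continuous_polarCoord_symm.measurable))
  simp_rw [h1]
  have hm : Measurable fun q : ℝ × ℝ => (Ioi (0 : ℝ)).indicator (fun s => ∫⁻ φ in Ioo (-π) π,
          ENNReal.ofReal s * G (cylEquiv (q.1, s * cos φ, s * sin φ))) q.2 := by
    have e : (fun q : ℝ × ℝ => (Ioi (0 : ℝ)).indicator (fun s => ∫⁻ φ in Ioo (-π) π,
          ENNReal.ofReal s * G (cylEquiv (q.1, s * cos φ, s * sin φ))) q.2)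
        = (univ ×ˢ Ioi (0 : ℝ)).indicator fun q : ℝ × ℝ => ∫⁻ φ in Ioo (-π) π,
          ENNReal.ofReal q.2 * G (cylEquiv (q.1, q.2 * cos φ, q.2 * sin φ)) := by
      ext q
      by_cases h : 0 < q.2 <;> simp [indicator, h]
    rw [e]
    refine Measurable.indicator ?_ (MeasurableSet.univ.prod measurableSet_Ioi)
    refine Measurable.lintegral_prod_right' (f := fun p : (ℝ × ℝ) × ℝ =>
      ENNReal.ofReal p.1.2 * G (cylEquiv (p.1.1, p.1.2 * cos p.2, p.1.2 * sin p.2))) ?_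
    refine Measurable.mul (by fun_prop) (hG.comp (hc.comp ?_))
    fun_prop
  rw [← lintegral_prod _ hm.aemeasurable, ← Measure.volume_eq_prod,
    ← lintegral_comp_polarCoord_symm, setLIntegral_polarCoord_target]
  swap
  · exact Measurable.mul (by fun_prop) (hm.comp continuous_polarCoord_symm.measurable)
  refine setLIntegral_congr_fun measurableSet_Ioi fun r hr => ?_
  have hr' : 0 < r := hr
  have h2 : ∀ θ ∈ Ioo (-π) π, ENNReal.ofReal r • (Ioi (0 : ℝ)).indicator (fun s =>
        ∫⁻ φ in Ioo (-π) π, ENNReal.ofReal s * G (cylEquiv (r * cos θ, s * cos φ, s * sin φ)))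
          (r * sin θ)
      = (Ioo 0 π).indicator (fun θ => ∫⁻ φ in Ioo (-π) π,
      ENNReal.ofReal (r ^ 2) * (ENNReal.ofReal (sin θ) * G (r • (spherePoint θ φ).1))) θ := by
    intro θ hθ
    by_cases h0 : 0 < θ
    · have hs : 0 < sin θ := sin_pos_of_pos_of_lt_pi h0 hθ.2
      rw [indicator_of_mem (show r * sin θ ∈ Ioi (0 : ℝ) from mul_pos hr' hs),
        indicator_of_mem (show θ ∈ Ioo 0 π from ⟨h0, hθ.2⟩), smul_eq_mul,
        ← lintegral_const_mul' _ _ ENNReal.ofReal_ne_top]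
      refine lintegral_congr fun φ => ?_
      have e : cylEquiv (r * cos θ, r * sin θ * cos φ, r * sin θ * sin φ)
          = r • (spherePoint θ φ).1 := by
        ext i; fin_cases i <;> simp [cylEquiv, spherePoint] <;> ring
      rw [e, ENNReal.ofReal_mul hr'.le, pow_two, ENNReal.ofReal_mul hr'.le]
      ring
    · have hs : sin θ ≤ 0 := sin_nonpos_of_nonpos_of_neg_pi_le (not_lt.mp h0) hθ.1.le
      rw [indicator_of_notMem, indicator_of_notMem, smul_zero]
      · exact fun h => h0 h.1
      · exact not_lt.mpr (mul_nonpos_of_nonneg_of_nonpos hr'.le hs)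
  simp only [polarCoord_symm_apply]
  rw [setLIntegral_congr_fun measurableSet_Ioo h2, lintegral_indicator measurableSet_Ioo,
    Measure.restrict_restrict measurableSet_Ioo]
  congr 2
  apply inter_eq_left.mpr
  exact Ioo_subset_Ioo_left (by linarith [pi_pos])

/-- The surface measure in spherical coordinates. -/
theorem surface_apply {s : Set S2} (hs : MeasurableSet s) :
    surface s = ∫⁻ θ in Ioo 0 π, ∫⁻ φ in Ioo (-π) π,
      ENNReal.ofReal (sin θ) * s.indicator 1 (spherePoint θ φ) := by
  rw [surface, Measure.toSphere_apply' _ hs, ← lintegral_indicator_one (measurableSet_cone hs),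
    lintegral_R3_eq _ (measurable_one.indicator (measurableSet_cone hs))]
  have h1 : ∀ r ∈ Ioi (0 : ℝ), (∫⁻ θ in Ioo 0 π, ∫⁻ φ in Ioo (-π) π,
      ENNReal.ofReal (r ^ 2) * (ENNReal.ofReal (sin θ) *
        (Ioo (0 : ℝ) 1 • (Subtype.val '' s) : Set R3).indicator 1 (r • (spherePoint θ φ).1)))
      = (Ioo 0 1).indicator (fun r => ENNReal.ofReal (r ^ 2)) r *
        ∫⁻ θ in Ioo 0 π, ∫⁻ φ in Ioo (-π) π,
          ENNReal.ofReal (sin θ) * s.indicator 1 (spherePoint θ φ) := by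
    intro r hr
    have hr' : 0 < r := hr
    by_cases h : r < 1
    · rw [indicator_of_mem (show r ∈ Ioo (0 : ℝ) 1 from ⟨hr, h⟩),
        ← lintegral_const_mul' _ _ ENNReal.ofReal_ne_top]
      refine lintegral_congr fun θ => ?_
      rw [← lintegral_const_mul' _ _ ENNReal.ofReal_ne_top]
      refine lintegral_congr fun φ => ?_
      congr 2
      by_cases hs' : spherePoint θ φ ∈ s
      · rw [indicator_of_mem hs', indicator_of_mem ((smul_spherePoint_mem_cone hr').mpr ⟨h, hs'⟩)]
        rfl
      · rw [indicator_of_notMem hs',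
          indicator_of_notMem fun h' => hs' ((smul_spherePoint_mem_cone hr').mp h').2]
    · rw [indicator_of_notMem (fun h' => h h'.2), zero_mul]
      simp [indicator, smul_spherePoint_mem_cone hr', h]
  rw [setLIntegral_congr_fun measurableSet_Ioi h1, lintegral_mul_const _ (by
    exact Measurable.indicator (by fun_prop) measurableSet_Ioo), ← mul_assoc]
  -- The dimension factor in the cone definition of the surface measure cancels `∫₀¹ r² dr = 1/3`.
  have h3 : (Module.finrank ℝ R3 : ℝ≥0∞) * ∫⁻ r in Ioi (0 : ℝ),
      (Ioo 0 1).indicator (fun r => ENNReal.ofReal (r ^ 2)) r = 1 := by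
    rw [lintegral_indicator measurableSet_Ioo, Measure.restrict_restrict measurableSet_Ioo,
      inter_eq_left.mpr (fun x hx => hx.1), Measure.restrict_congr_set Ioo_ae_eq_Ioc,
      ← ofReal_integral_eq_lintegral_ofReal, ← intervalIntegral.integral_of_le zero_le_one]
    · simp only [integral_pow]
      simp
      rw [← ENNReal.ofReal_ofNat 3, ← ENNReal.ofReal_mul (by norm_num)]
      norm_num
    · exact (intervalIntegral.intervalIntegrable_pow 2).1
    · exact Filter.Eventually.of_forall fun x => by positivity
  rw [h3, one_mul]

theorem surface_eq_map : surface = (((volume.restrict (Ioo 0 π)).withDensity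
      fun θ => ENNReal.ofReal (sin θ)).prod (volume.restrict (Ioo (-π) π))).map
        (fun p => spherePoint p.1 p.2) := by
  ext s hs
  have hm := continuous_spherePoint.measurable
  rw [surface_apply hs, Measure.map_apply hm hs, ← lintegral_indicator_one (hm hs),
    lintegral_prod _ (measurable_one.indicator (hm hs)).aemeasurable,
    lintegral_withDensity_eq_lintegral_mul _ (by fun_prop)]
  · refine lintegral_congr fun θ => ?_
    rw [Pi.mul_apply, ← lintegral_const_mul' _ _ ENNReal.ofReal_ne_top]
    rfl
  · exact Measurable.lintegral_prod_right' (measurable_one.indicator (hm hs))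

end BlochCoherent

end

/-! ### Archimedes' theorem and the resolution of the identity. -/

noncomputable section

namespace BlochCoherent

open MeasureTheory Set Real
open scoped ENNReal

/-- Archimedes: the height is uniformly distributed. -/
theorem map_height_surface : surface.map (fun ω : S2 => (1 + ω.1 2) / 2)
    = ENNReal.ofReal (4 * π) • volume.restrict (Ioo (0 : ℝ) 1) := by
  have hm : Measurable fun ω : S2 => (1 + ω.1 2) / 2 := by
    have : Measurable fun ω : S2 => ω.1 2 := by fun_prop
    fun_prop
  ext B hB
  rw [Measure.map_apply hm hB, surface_apply (hm hB), Measure.smul_apply, smul_eq_mul,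
    ← lintegral_indicator_one hB]
  have himg : (fun θ => (1 + cos θ) / 2) '' Ioo 0 π = Ioo (0 : ℝ) 1 := by
    ext t
    constructor
    · rintro ⟨θ, hθ, rfl⟩
      have h1 : cos θ < 1 := by
        rw [← cos_zero]; exact cos_lt_cos_of_nonneg_of_le_pi le_rfl hθ.2.le hθ.1
      have h2 : -1 < cos θ := by
        rw [← cos_pi]; exact cos_lt_cos_of_nonneg_of_le_pi hθ.1.le le_rfl hθ.2
      constructor <;> simp only <;> linarith
    · rintro ⟨h0, h1⟩
      refine ⟨arccos (2 * t - 1), ⟨arccos_pos.mpr (by linarith), ?_⟩, ?_⟩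
      · refine lt_of_le_of_ne (arccos_le_pi _) fun h => ?_
        rw [arccos_eq_pi] at h; linarith
      · simp only
        rw [cos_arccos (by linarith) (by linarith)]; ring
  rw [← himg, lintegral_image_eq_lintegral_abs_deriv_mul (f' := fun θ => -sin θ / 2)
    measurableSet_Ioo (fun θ _ => (((hasDerivAt_cos θ).const_add 1).div_const 2).hasDerivWithinAt),
    ← lintegral_const_mul' _ _ ENNReal.ofReal_ne_top]
  · refine setLIntegral_congr_fun measurableSet_Ioo fun θ hθ => ?_
    have hs : 0 < sin θ := sin_pos_of_mem_Ioo hθ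
    have e : ∀ φ, (((fun ω : S2 => (1 + ω.1 2) / 2) ⁻¹' B).indicator 1 (spherePoint θ φ) : ℝ≥0∞)
        = B.indicator 1 ((1 + cos θ) / 2) := by
      intro φ
      have : (spherePoint θ φ).1 2 = cos θ := rfl
      simp only [indicator, mem_preimage, this, Pi.one_apply]
      rfl
    simp only [e]
    rw [lintegral_const, Measure.restrict_apply_univ, Real.volume_Ioo, neg_div, abs_neg,
      abs_of_pos (by positivity), ← mul_assoc, ← ENNReal.ofReal_mul (by positivity), mul_right_comm,
      ← ENNReal.ofReal_mul hs.le]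
    congr 2; ring
  · intro x hx y hy hxy
    apply injOn_cos ⟨hx.1.le, hx.2.le⟩ ⟨hy.1.le, hy.2.le⟩
    simp only at hxy
    linarith

/-- Integration by parts: the value does not depend on `i`, because the boundary terms of `t^(m+1)
(1-t)^(i+1)` vanish. -/
theorem integral_choose_mul_pow (n i : ℕ) (hi : i ≤ n) :
    ∫ t in (0 : ℝ)..1, (n.choose i : ℝ) * (t ^ (n - i) * (1 - t) ^ i) = 1 / (n + 1) := by
  induction i with
  | zero => simp
  | succ i ih =>
    rw [← ih (by omega)]
    obtain ⟨m, hm⟩ : ∃ m, n - i = m + 1 := ⟨n - i - 1, by omega⟩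
    have hm' : n - (i + 1) = m := by omega
    rw [hm, hm']
    have hd : ∀ t ∈ uIcc (0 : ℝ) 1, HasDerivAt (fun t : ℝ => t ^ (m + 1) * (1 - t) ^ (i + 1))
        (((m + 1 : ℕ) : ℝ) * t ^ m * (1 - t) ^ (i + 1)
          + t ^ (m + 1) * (((i + 1 : ℕ) : ℝ) * (1 - t) ^ i * (-1))) t := by
      intro t _
      exact (hasDerivAt_pow (m + 1) t).mul (((hasDerivAt_id t).const_sub 1).pow (i + 1))
    have h := intervalIntegral.integral_eq_sub_of_hasDerivAt hd
      (Continuous.intervalIntegrable (by fun_prop) _ _)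
    rw [intervalIntegral.integral_add (Continuous.intervalIntegrable (by fun_prop) _ _)
      (Continuous.intervalIntegrable (by fun_prop) _ _)] at h
    have hc := congrArg (Nat.cast (R := ℝ)) (Nat.choose_succ_right_eq n i)
    rw [hm] at hc
    have e1 : ∫ t in (0 : ℝ)..1, (n.choose (i + 1) : ℝ) * (t ^ m * (1 - t) ^ (i + 1))
        = (n.choose (i + 1) : ℝ) / ((m + 1 : ℕ) : ℝ)
          * ∫ t in (0 : ℝ)..1, ((m + 1 : ℕ) : ℝ) * t ^ m * (1 - t) ^ (i + 1) := by
      rw [← intervalIntegral.integral_const_mul]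
      congr 1; ext t
      field_simp
    have e2 : ∫ t in (0 : ℝ)..1, (n.choose i : ℝ) * (t ^ (m + 1) * (1 - t) ^ i)
        = -((n.choose i : ℝ) / ((i + 1 : ℕ) : ℝ))
          * ∫ t in (0 : ℝ)..1, t ^ (m + 1) * (((i + 1 : ℕ) : ℝ) * (1 - t) ^ i * (-1)) := by
      rw [← intervalIntegral.integral_const_mul]
      congr 1; ext t
      field_simp
    have h0 : (0 : ℝ) < ((i + 1 : ℕ) : ℝ) := by positivity
    have h1 : (0 : ℝ) < ((m + 1 : ℕ) : ℝ) := by positivity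
    have hc' : (n.choose (i + 1) : ℝ) / ((m + 1 : ℕ) : ℝ) = (n.choose i : ℝ) / ((i + 1 : ℕ) : ℝ) := by
      rw [div_eq_div_iff h1.ne' h0.ne']
      exact_mod_cast hc
    rw [e1, e2, hc']
    have h' := eq_neg_of_add_eq_zero_left (h.trans (by simp))
    rw [h']; ring

theorem isSpinor_spherePoint (θ φ : ℝ) : IsSpinor (spherePoint θ φ) (cos (θ / 2) : ℝ)
    ((sin (θ / 2) : ℝ) * Complex.exp (φ * Complex.I)) := by
  have h := cos_sq_add_sin_sq (θ / 2)
  have hs : sin θ = 2 * sin (θ / 2) * cos (θ / 2) := by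
    rw [← sin_two_mul]; congr 1; ring
  have hc : cos θ = cos (θ / 2) ^ 2 - sin (θ / 2) ^ 2 := by
    rw [← cos_two_mul']; congr 1; ring
  have hB : Complex.normSq ((sin (θ / 2) : ℝ) * Complex.exp (φ * Complex.I))
      = sin (θ / 2) ^ 2 := by
    rw [Complex.normSq_eq_norm_sq, norm_mul, Complex.norm_exp_ofReal_mul_I, mul_one,
      Complex.norm_real, Real.norm_eq_abs, sq_abs]
  have h0 : (spherePoint θ φ).1 0 = sin θ * cos φ := rfl
  have h1 : (spherePoint θ φ).1 1 = sin θ * sin φ := rfl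
  have h2 : (spherePoint θ φ).1 2 = cos θ := rfl
  refine ⟨?_, ?_, ?_⟩
  · rw [hB, Complex.normSq_ofReal]; linarith
  · rw [hB, Complex.normSq_ofReal, h2, hc]; ring
  · rw [h0, h1, hs, Complex.conj_ofReal, Complex.exp_mul_I]
    push_cast
    ring

theorem integral_exp_mul_I {m : ℤ} (hm : m ≠ 0) :
    ∫ φ in Ioo (-π) π, Complex.exp (φ * Complex.I) ^ m = 0 := by
  rw [Measure.restrict_congr_set Ioo_ae_eq_Ioc,
    ← intervalIntegral.integral_of_le (by linarith [pi_pos])]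
  have hc : (m : ℂ) * Complex.I ≠ 0 := mul_ne_zero (by exact_mod_cast hm) Complex.I_ne_zero
  have e : ∀ φ : ℝ, Complex.exp (φ * Complex.I) ^ m = Complex.exp (m * Complex.I * φ) := by
    intro φ
    rw [← Complex.exp_int_mul]; congr 1; ring
  simp_rw [e]
  rw [integral_exp_mul_complex hc, div_eq_zero_iff, sub_eq_zero]
  left
  rw [Complex.exp_eq_exp_iff_exists_int]
  exact ⟨m, by push_cast; ring⟩

theorem integral_surface_height (h : ℝ → ℝ) (hh : Measurable h) :
    ∫ ω : S2, h ((1 + ω.1 2) / 2) ∂surface = 4 * π * ∫ t in Ioo (0 : ℝ) 1, h t := by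
  have hm : Measurable fun ω : S2 => (1 + ω.1 2) / 2 := by
    have : Measurable fun ω : S2 => ω.1 2 := by fun_prop
    fun_prop
  rw [← integral_map (f := h) hm.aemeasurable hh.aestronglyMeasurable, map_height_surface,
    integral_smul_measure, ENNReal.toReal_ofReal (by positivity), smul_eq_mul]

/-- The area measure in spherical coordinates. -/
abbrev angleMeasure : Measure (ℝ × ℝ) :=
  ((volume.restrict (Ioo 0 π)).withDensity fun θ => ENNReal.ofReal (sin θ)).prod
    (volume.restrict (Ioo (-π) π))

/-- The coherent vector in the direction with polar angle `p.1` and azimuth `p.2`. -/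
abbrev angleVec (n : ℕ) (p : ℝ × ℝ) : SpinSpace n :=
  coherentVec n (cos (p.1 / 2) : ℝ) ((sin (p.1 / 2) : ℝ) * Complex.exp (p.2 * Complex.I))

/-- The azimuthal phases `e^{i(j-i)φ}` kill off-diagonal entries; on the diagonal the height is
uniform and a Beta integral remains. -/
theorem integral_conj_angleVec_mul (n : ℕ) (i j : Fin (n + 1)) :
    ∫ p, starRingEnd ℂ (angleVec n p i) * angleVec n p j ∂angleMeasure
      = if i = j then ((4 * π / (n + 1) : ℝ) : ℂ) else 0 := by
  have e : ∀ p : ℝ × ℝ, starRingEnd ℂ (angleVec n p i) * angleVec n p j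
      = ((√(n.choose i) * (cos (p.1 / 2) ^ (n - (i : ℕ)) * sin (p.1 / 2) ^ (i : ℕ))
          * (√(n.choose j) * (cos (p.1 / 2) ^ (n - (j : ℕ)) * sin (p.1 / 2) ^ (j : ℕ))) : ℝ) : ℂ)
        * Complex.exp (p.2 * Complex.I) ^ ((j : ℤ) - (i : ℤ)) := by
    intro p
    have hE : starRingEnd ℂ (Complex.exp (p.2 * Complex.I))
        = (Complex.exp (p.2 * Complex.I))⁻¹ := by
      rw [← Complex.exp_conj, ← Complex.exp_neg]
      simp
    rw [zpow_sub₀ (Complex.exp_ne_zero _), zpow_natCast, zpow_natCast]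
    simp only [angleVec, coherentVec, ofCoeffs, map_mul, map_pow, Complex.conj_ofReal, hE]
    push_cast
    rw [mul_pow, mul_pow, inv_pow]
    ring
  split_ifs with hij
  · subst hij
    have e2 : ∀ p : ℝ × ℝ, starRingEnd ℂ (angleVec n p i) * angleVec n p i
        = (((n.choose i : ℝ) * (((1 + (spherePoint p.1 p.2).1 2) / 2) ^ (n - (i : ℕ))
          * (1 - (1 + (spherePoint p.1 p.2).1 2) / 2) ^ (i : ℕ)) : ℝ) : ℂ) := by
      intro p
      have h2 : (spherePoint p.1 p.2).1 2 = cos p.1 := rfl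
      have hc : cos p.1 = 2 * cos (p.1 / 2) ^ 2 - 1 := by
        rw [← cos_two_mul]; congr 1; ring
      have hs := cos_sq_add_sin_sq (p.1 / 2)
      have h3 : (1 + cos p.1) / 2 = cos (p.1 / 2) ^ 2 := by rw [hc]; ring
      have h4 : 1 - cos (p.1 / 2) ^ 2 = sin (p.1 / 2) ^ 2 := by linarith
      rw [e, sub_self, zpow_zero, mul_one, h2, h3, h4]
      congr 1
      have hq := Real.mul_self_sqrt (Nat.cast_nonneg (α := ℝ) (n.choose i))
      linear_combination (cos (p.1 / 2) ^ (n - (i : ℕ)) * sin (p.1 / 2) ^ (i : ℕ)) ^ 2 * hq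
    simp_rw [e2]
    rw [integral_complex_ofReal]
    congr 1
    have hmeas : Measurable fun ω : S2 => (n.choose i : ℝ) * (((1 + ω.1 2) / 2) ^ (n - (i : ℕ))
          * (1 - (1 + ω.1 2) / 2) ^ (i : ℕ)) := by
      have : Measurable fun ω : S2 => ω.1 2 := by fun_prop
      fun_prop
    have h5 := integral_map (μ := angleMeasure) continuous_spherePoint.measurable.aemeasurable
      (hmeas.aestronglyMeasurable)
    rw [← surface_eq_map] at h5
    rw [← h5, integral_surface_height (fun t => (n.choose i : ℝ) * (t ^ (n - (i : ℕ))
          * (1 - t) ^ (i : ℕ))) (by fun_prop), Measure.restrict_congr_set Ioo_ae_eq_Ioc,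
      ← intervalIntegral.integral_of_le zero_le_one, integral_choose_mul_pow n i (by omega)]
    ring
  · simp_rw [e]
    rw [integral_prod_mul (fun θ : ℝ => ((√(n.choose i) * (cos (θ / 2) ^ (n - (i : ℕ))
        * sin (θ / 2) ^ (i : ℕ)) * (√(n.choose j) * (cos (θ / 2) ^ (n - (j : ℕ))
        * sin (θ / 2) ^ (j : ℕ))) : ℝ) : ℂ))
      (fun φ : ℝ => Complex.exp (φ * Complex.I) ^ ((j : ℤ) - (i : ℤ))),
      integral_exp_mul_I, mul_zero]
    intro h
    apply hij
    ext
    omega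

instance : IsFiniteMeasure angleMeasure := by
  refine ⟨?_⟩
  have h := measure_lt_top surface univ
  rwa [surface_eq_map, Measure.map_apply continuous_spherePoint.measurable MeasurableSet.univ,
    preimage_univ] at h

theorem integrable_conj_angleVec_mul (n : ℕ) (i j : Fin (n + 1)) :
    Integrable (fun p => starRingEnd ℂ (angleVec n p i) * angleVec n p j) angleMeasure := by
  have hc : ∀ i, Continuous fun p => angleVec n p i := by
    intro i
    simp only [angleVec, coherentVec, ofCoeffs]
    fun_prop
  have hb : ∀ i p, ‖angleVec n p i‖ ≤ 1 := by
    intro i p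
    rw [← norm_coherentVec n (isSpinor_spherePoint p.1 p.2).add_eq]
    exact PiLp.norm_apply_le _ i
  refine Integrable.of_bound ((Complex.continuous_conj.comp (hc i)).mul
    (hc j)).aestronglyMeasurable 1 (Filter.Eventually.of_forall fun p => ?_)
  rw [norm_mul, RCLike.norm_conj]
  exact mul_le_one₀ (hb i p) (norm_nonneg _) (hb j p)

theorem measurable_lowerSymbol {n : ℕ} (ρ : SpinSpace n →ₗ[ℂ] SpinSpace n) :
    Measurable (lowerSymbol ρ) := by
  have e : lowerSymbol ρ = fun ω => (inner ℂ (coherentVec n (spinorA ω) (spinorB ω))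
      (ρ (coherentVec n (spinorA ω) (spinorB ω)))).re :=
    funext fun ω => lowerSymbol_eq ρ (isSpinor_spinor ω)
  rw [e]
  have hv : Measurable fun ω => coherentVec n (spinorA ω) (spinorB ω) := by
    refine (PiLp.continuous_toLp 2 _).measurable.comp (measurable_pi_lambda _ fun i => ?_)
    have h1 := measurable_spinorA
    have h2 := measurable_spinorB
    fun_prop
  have hρ : Measurable ρ := ρ.continuous_of_finiteDimensional.measurable
  exact Complex.measurable_re.comp (hv.inner (hρ.comp hv))

/-- The coherent states resolve the identity. -/
theorem integral_lowerSymbol {n : ℕ} (ρ : SpinSpace n →ₗ[ℂ] SpinSpace n) :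
    ∫ ω, lowerSymbol ρ ω ∂surface
      = 4 * π / (n + 1) * (LinearMap.trace ℂ (SpinSpace n) ρ).re := by
  rw [surface_eq_map, integral_map continuous_spherePoint.measurable.aemeasurable
    (measurable_lowerSymbol ρ).aestronglyMeasurable]
  set b := EuclideanSpace.basisFun (Fin (n + 1)) ℂ with hb
  have e : ∀ p : ℝ × ℝ, lowerSymbol ρ (spherePoint p.1 p.2)
      = (∑ i, ∑ j, (ρ (b j)) i * (starRingEnd ℂ (angleVec n p i) * angleVec n p j)).re := by
    intro p
    rw [lowerSymbol_eq ρ (isSpinor_spherePoint p.1 p.2)]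
    congr 1
    have hv : ρ (angleVec n p) = ∑ j, angleVec n p j • ρ (b j) := by
      conv_lhs => rw [← b.sum_repr (angleVec n p), map_sum]
      refine Finset.sum_congr rfl fun j _ => ?_
      rw [map_smul]; simp [hb]
    change inner ℂ (angleVec n p) (ρ (angleVec n p)) = _
    rw [hv, PiLp.inner_apply]
    refine Finset.sum_congr rfl fun i _ => ?_
    rw [WithLp.ofLp_sum, Finset.sum_apply, inner_sum]
    refine Finset.sum_congr rfl fun j _ => ?_
    simp
    ring
  simp_rw [e]
  have hint : ∀ i j, Integrable (fun p => (ρ (b j)) i *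
      (starRingEnd ℂ (angleVec n p i) * angleVec n p j)) angleMeasure :=
    fun i j => (integrable_conj_angleVec_mul n i j).const_mul _
  have hre := integral_re (𝕜 := ℂ) (μ := angleMeasure) (integrable_finsetSum Finset.univ
    fun i _ => integrable_finsetSum Finset.univ fun j _ => hint i j)
  refine hre.trans ?_
  rw [integral_finsetSum _ fun i _ => integrable_finsetSum Finset.univ fun j _ => hint i j]
  have : ∀ i, ∫ p, ∑ j, (ρ (b j)) i * (starRingEnd ℂ (angleVec n p i) * angleVec n p j)
      ∂angleMeasure = ((4 * π / (n + 1) : ℝ) : ℂ) * (ρ (b i)) i := by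
    intro i
    rw [integral_finsetSum _ fun j _ => hint i j, Finset.sum_eq_single i]
    · rw [integral_const_mul, integral_conj_angleVec_mul, if_pos rfl, mul_comm]
    · intro j _ hj
      rw [integral_const_mul, integral_conj_angleVec_mul, if_neg hj.symm, mul_zero]
    · simp
  simp_rw [this]
  rw [← Finset.mul_sum, LinearMap.trace_eq_sum_inner ρ b]
  simp only [hb, EuclideanSpace.basisFun_inner]
  rw [RCLike.re_eq_complex_re, Complex.re_ofReal_mul]

end BlochCoherent

end

/-! ### Jensen, majorization, and the bound at finite `N`. -/

noncomputable section

namespace BlochCoherent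

open MeasureTheory Set Real Filter Topology
open scoped ENNReal

theorem isDensity_rankOne {n : ℕ} (u : SpinSpace n) (hu : ‖u‖ = 1) :
    IsDensity (InnerProductSpace.rankOne ℂ u u).toLinearMap := by
  constructor
  · refine ⟨fun x y => ?_, fun x => ?_⟩
    · simp [inner_smul_left, inner_smul_right]; ring
    · simp only [ContinuousLinearMap.coe_coe, InnerProductSpace.rankOne_apply, inner_smul_left,
        inner_conj_symm]
      rw [← inner_conj_symm x u, ← Complex.normSq_eq_conj_mul_self]
      exact_mod_cast Complex.normSq_nonneg _
  · rw [InnerProductSpace.trace_rankOne, inner_self_eq_norm_sq_to_K, hu]; simp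

theorem lowerSymbol_rankOne {n : ℕ} (u : SpinSpace n) {ω : S2} {α β : ℂ} (h : IsSpinor ω α β) :
    lowerSymbol (InnerProductSpace.rankOne ℂ u u).toLinearMap ω
      = ‖inner ℂ u (coherentVec n α β)‖ ^ 2 := by
  rw [lowerSymbol_eq _ h, ContinuousLinearMap.coe_coe, InnerProductSpace.rankOne_apply,
    inner_smul_right, ← inner_conj_symm (coherentVec n α β), mul_comm,
    ← Complex.normSq_eq_conj_mul_self, Complex.normSq_eq_norm_sq, Complex.ofReal_re]

theorem sum_range_choose_sub_div {n k N : ℕ} (h : n + k = N) :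
    ∑ i ∈ Finset.range (N + 1), ((N - i).choose n : ℝ) / (N.choose n : ℝ) = (N + 1) / (n + 1) := by
  have h1 : ∑ i ∈ Finset.range (N + 1), (N - i).choose n = (N + 1).choose (n + 1) := by
    rw [← Nat.sum_Icc_choose, ← Finset.sum_range_reflect]
    symm
    apply Finset.sum_subset_zero_on_sdiff (by intro x; simp)
    · intro j hj
      have : N - (N + 1 - 1 - j) < n := by simp at hj; omega
      exact Nat.choose_eq_zero_of_lt this
    · intro j hj
      have : N - (N + 1 - 1 - j) = j := by simp at hj; omega
      rw [this]
  have hN : (0 : ℝ) < N.choose n := by exact_mod_cast Nat.choose_pos (by omega)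
  have h2 := congrArg (Nat.cast (R := ℝ)) (Nat.add_one_mul_choose_eq N n)
  rw [← Finset.sum_div, div_eq_div_iff hN.ne' (by positivity)]
  rw [← Nat.cast_sum, h1]
  push_cast at h2 ⊢
  linarith

/-- The diagonal form of the output state together with its total mass. -/
theorem exists_lowerSymbol_decomposition {n k N : ℕ} (h : n + k = N)
    {ρ : SpinSpace n →ₗ[ℂ] SpinSpace n} (hρ : IsDensity ρ) :
    ∃ (l : ℕ → ℝ) (W : ℕ → S2 → ℝ),
      (∀ i j, i ≤ j → j ≤ N → l j ≤ l i) ∧ (∀ i, i ≤ N → l i ∈ Icc (0 : ℝ) 1) ∧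
      (∀ m, m ≤ N + 1 → ∑ i ∈ Finset.range m, l i
        ≤ ∑ i ∈ Finset.range m, ((N - i).choose n : ℝ) / (N.choose n : ℝ)) ∧
      ∑ i ∈ Finset.range (N + 1), l i = (N + 1) / (n + 1) ∧
      (∀ i ω, 0 ≤ W i ω) ∧ (∀ ω, ∑ i ∈ Finset.range (N + 1), W i ω = 1) ∧
      (∀ i, Integrable (W i) surface) ∧ (∀ i ≤ N, ∫ ω, W i ω ∂surface = 4 * π / (N + 1)) ∧
      ∀ ω, lowerSymbol ρ ω = ∑ i ∈ Finset.range (N + 1), W i ω * l i := by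
  obtain ⟨l, u, hl1, hl2, hl3, hl4⟩ := exists_majorized_spectrum h hρ
  have hN0 : (N.choose n : ℝ) ≠ 0 := by exact_mod_cast (Nat.choose_pos (by omega)).ne'
  set W : ℕ → S2 → ℝ := fun i ω => if hi : i < N + 1 then
    lowerSymbol (InnerProductSpace.rankOne ℂ (u ⟨i, hi⟩) (u ⟨i, hi⟩)).toLinearMap ω else 0 with hW
  have hWu : ∀ (i : Fin (N + 1)) ω,
      W i ω = ‖inner ℂ (u i) (coherentVec N (spinorA ω) (spinorB ω))‖ ^ 2 := by
    intro i ω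
    simp only [hW]
    rw [dif_pos i.2, lowerSymbol_rankOne _ (isSpinor_spinor ω)]
  have hW0 : ∀ i ω, 0 ≤ W i ω := by
    intro i ω
    by_cases hi : i < N + 1
    · rw [hWu ⟨i, hi⟩]; positivity
    · simp only [hW]; rw [dif_neg hi]
  have hW1 : ∀ ω, ∑ i ∈ Finset.range (N + 1), W i ω = 1 := by
    intro ω
    rw [Finset.sum_range]
    simp_rw [hWu]
    rw [u.sum_sq_norm_inner_right, norm_coherentVec N (isSpinor_spinor ω).add_eq, one_pow]
  have hWi : ∀ i, Integrable (W i) surface := by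
    intro i
    by_cases hi : i < N + 1
    · have hm : Measurable (W i) := by
        simp only [hW, dif_pos hi]
        exact measurable_lowerSymbol _
      refine Integrable.of_bound hm.aestronglyMeasurable 1 (Eventually.of_forall fun ω => ?_)
      rw [Real.norm_of_nonneg (hW0 i ω), ← hW1 ω]
      exact Finset.single_le_sum (f := fun i => W i ω) (fun j _ => hW0 j ω) (by simpa using hi)
    · have : W i = fun _ => 0 := by ext ω; simp only [hW]; rw [dif_neg hi]
      rw [this]; exact integrable_zero _ _ _
  have hWint : ∀ i ≤ N, ∫ ω, W i ω ∂surface = 4 * π / (N + 1) := by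
    intro i hi
    have hi' : i < N + 1 := by omega
    simp only [hW, dif_pos hi']
    rw [integral_lowerSymbol, (isDensity_rankOne _ (u.orthonormal.1 _)).2]
    simp
  have hsym : ∀ ω, lowerSymbol ρ ω = ∑ i ∈ Finset.range (N + 1), W i ω * l i := by
    intro ω
    rw [lowerSymbol_eq ρ (isSpinor_spinor ω), hl4 _ _ (isSpinor_spinor ω).add_eq, Finset.sum_range]
    exact Finset.sum_congr rfl fun i _ => by rw [hWu, mul_comm]
  refine ⟨l, W, hl1, fun i hi => ⟨hl2 i hi, ?_⟩, hl3, ?_, hW0, hW1, hWi, hWint, hsym⟩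
  -- Majorization with one term bounds the largest eigenvalue by `C(N,n)/C(N,n) = 1`.
  · have := hl3 1 (by omega)
    simp only [Finset.sum_range_one, Nat.sub_zero, div_self hN0] at this
    exact (hl1 0 i (by omega) hi).trans this
  -- The eigenvalue sum is read off by integrating the decomposition of the symbol, as every weight
  -- has the same integral.
  · have h1 := integral_lowerSymbol ρ
    simp_rw [hsym] at h1
    rw [integral_finsetSum _ fun i _ => (hWi i).mul_const _, hρ.2] at h1
    have h2 : ∑ i ∈ Finset.range (N + 1), ∫ ω, W i ω * l i ∂surface
        = 4 * π / (N + 1) * ∑ i ∈ Finset.range (N + 1), l i := by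
      rw [Finset.mul_sum]
      refine Finset.sum_congr rfl fun i hi => ?_
      rw [integral_mul_const, hWint i (by simp at hi; omega)]
    rw [h2, Complex.one_re, mul_one] at h1
    have hpi := pi_pos
    field_simp at h1 ⊢
    linarith

theorem lowerSymbol_mem_Icc {n : ℕ} {ρ : SpinSpace n →ₗ[ℂ] SpinSpace n} (hρ : IsDensity ρ)
    (ω : S2) : lowerSymbol ρ ω ∈ Icc (0 : ℝ) 1 := by
  -- Taking `k = 0` exhibits the symbol as a convex combination of numbers in `[0,1]`.
  obtain ⟨l, W, -, hl, -, -, hW0, hW1, -, -, hsym⟩ :=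
    exists_lowerSymbol_decomposition (add_zero n) hρ
  rw [hsym]
  exact (convex_Icc (0 : ℝ) 1).sum_mem (fun i _ => hW0 i ω) (hW1 ω)
    (fun i hi => hl i (by simp at hi; omega))

/-- A function continuous on the open unit interval is Borel on the closed one. -/
theorem exists_measurable_eqOn {f : ℝ → ℝ} (hf : ContinuousOn f (Ioo 0 1)) :
    ∃ g : ℝ → ℝ, Measurable g ∧ EqOn f g (Icc 0 1) := by
  classical
  refine ⟨fun t => if t = 0 then f 0 else if t = 1 then f 1 else (Ioo (0 : ℝ) 1).piecewise f 0 t,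
    ?_, ?_⟩
  · refine Measurable.ite (measurableSet_singleton 0) measurable_const ?_
    refine Measurable.ite (measurableSet_singleton 1) measurable_const ?_
    exact hf.measurable_piecewise continuousOn_const measurableSet_Ioo
  · intro t ht
    simp only
    split_ifs with h0 h1
    · rw [h0]
    · rw [h1]
    · rw [piecewise_eq_of_mem]
      exact ⟨lt_of_le_of_ne ht.1 (Ne.symm h0), lt_of_le_of_ne ht.2 h1⟩

theorem _root_.ConcaveOn.continuousOn_Ioo {f : ℝ → ℝ} (hf : ConcaveOn ℝ (Icc 0 1) f) :
    ContinuousOn f (Ioo 0 1) := by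
  simpa using hf.continuousOn_interior

/-- Endpoint values bound `f` from below. Concavity at the midpoint of `t` and `1 - t` turns this
into an upper bound. -/
theorem _root_.ConcaveOn.exists_abs_le {f : ℝ → ℝ} (hf : ConcaveOn ℝ (Icc 0 1) f) :
    ∃ M, ∀ t ∈ Icc (0 : ℝ) 1, |f t| ≤ M := by
  have hlow : ∀ t ∈ Icc (0 : ℝ) 1, min (f 0) (f 1) ≤ f t := by
    intro t ht
    exact hf.min_le_of_mem_Icc (by simp) (by simp) ht
  refine ⟨max (-min (f 0) (f 1)) (2 * f (1 / 2) - min (f 0) (f 1)), fun t ht => ?_⟩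
  have h1 := hlow t ht
  have ht' : 1 - t ∈ Icc (0 : ℝ) 1 := ⟨by linarith [ht.2], by linarith [ht.1]⟩
  have h2 := hlow (1 - t) ht'
  have h3 := hf.2 ht ht' (by norm_num : (0 : ℝ) ≤ 1 / 2) (by norm_num : (0 : ℝ) ≤ 1 / 2)
    (by norm_num)
  simp only [smul_eq_mul] at h3
  rw [show 1 / 2 * t + 1 / 2 * (1 - t) = (1 / 2 : ℝ) by ring] at h3
  rw [abs_le]
  constructor
  · have := le_max_left (-min (f 0) (f 1)) (2 * f (1 / 2) - min (f 0) (f 1)); linarith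
  · have := le_max_right (-min (f 0) (f 1)) (2 * f (1 / 2) - min (f 0) (f 1)); linarith

theorem integrable_comp_of_concaveOn {f : ℝ → ℝ} (hf : ConcaveOn ℝ (Icc 0 1) f) {X : Type*}
    [MeasurableSpace X] {μ : Measure X} [IsFiniteMeasure μ] {s : X → ℝ} (hs : Measurable s)
    (h01 : ∀ x, s x ∈ Icc (0 : ℝ) 1) : Integrable (fun x => f (s x)) μ := by
  obtain ⟨g, hg, hfg⟩ := exists_measurable_eqOn hf.continuousOn_Ioo
  obtain ⟨M, hM⟩ := hf.exists_abs_le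
  have e : (fun x => f (s x)) = fun x => g (s x) := funext fun x => hfg (h01 x)
  refine Integrable.of_bound ?_ M (Eventually.of_forall fun x => hM _ (h01 x))
  rw [e]
  exact (hg.comp hs).aestronglyMeasurable

theorem averageFinite_of_concaveOn {f : ℝ → ℝ} (hf : ConcaveOn ℝ (Icc 0 1) f) {n : ℕ}
    {ρ : SpinSpace n →ₗ[ℂ] SpinSpace n} (hρ : IsDensity ρ) : AverageFinite f ρ :=
  integrable_comp_of_concaveOn hf (measurable_lowerSymbol ρ) (lowerSymbol_mem_Icc hρ)

/-- The Berezin–Lieb inequality for the output state, combined with majorization. -/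
theorem sum_le_integral_lowerSymbol {f : ℝ → ℝ} (hf : ConcaveOn ℝ (Icc 0 1) f) {n k N : ℕ}
    (h : n + k = N) {ρ : SpinSpace n →ₗ[ℂ] SpinSpace n} (hρ : IsDensity ρ) :
    4 * π * ((∑ i ∈ Finset.range (N + 1), f (((N - i).choose n : ℝ) / (N.choose n : ℝ))) / (N + 1))
      ≤ ∫ ω, f (lowerSymbol ρ ω) ∂surface := by
  obtain ⟨l, W, hl1, hl, hl3, hl4, hW0, hW1, hWi, hWint, hsym⟩ :=
    exists_lowerSymbol_decomposition h hρ
  have hN0 : (0 : ℝ) < N.choose n := by exact_mod_cast Nat.choose_pos (by omega)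
  have hK : ∑ i ∈ Finset.range (N + 1), f (((N - i).choose n : ℝ) / (N.choose n : ℝ))
      ≤ ∑ i ∈ Finset.range (N + 1), f (l i) := by
    refine sum_le_sum_of_majorized hf (fun i hi => hl i (by omega)) (fun i hi => ?_)
      (fun i j hij hj => hl1 i j hij (by omega)) (fun i j hij hj => ?_) hl3
      (hl4.trans (sum_range_choose_sub_div h).symm)
    · refine ⟨by positivity, (div_le_one hN0).mpr ?_⟩
      exact_mod_cast Nat.choose_le_choose n (Nat.sub_le N i)
    · gcongr
  have hJ : ∀ ω, ∑ i ∈ Finset.range (N + 1), W i ω * f (l i) ≤ f (lowerSymbol ρ ω) := by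
    intro ω
    rw [hsym]
    exact hf.le_map_sum (fun i _ => hW0 i ω) (hW1 ω) (fun i hi => hl i (by simp at hi; omega))
  calc _ ≤ 4 * π * ((∑ i ∈ Finset.range (N + 1), f (l i)) / (N + 1)) := by gcongr
    _ = ∫ ω, ∑ i ∈ Finset.range (N + 1), W i ω * f (l i) ∂surface := by
      rw [integral_finsetSum _ fun i _ => (hWi i).mul_const _, Finset.sum_div, Finset.mul_sum]
      refine Finset.sum_congr rfl fun i hi => ?_
      rw [integral_mul_const, hWint i (by simp at hi; omega)]
      ring
    _ ≤ _ := integral_mono (integrable_finsetSum _ fun i _ => (hWi i).mul_const _)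
      (averageFinite_of_concaveOn hf hρ) hJ

/-! ### Riemann sums and the limit `N → ∞`. -/

theorem integral_comp_floor_mul (G : ℕ → ℝ) (N : ℕ) :
    ∫ t in Ioo (0 : ℝ) 1, G ⌊((N : ℝ) + 1) * t⌋₊
      = (∑ j ∈ Finset.range (N + 1), G j) / (N + 1) := by
  have hN : (0 : ℝ) < (N : ℝ) + 1 := by positivity
  rw [Measure.restrict_congr_set Ioo_ae_eq_Ioc, ← intervalIntegral.integral_of_le zero_le_one,
    intervalIntegral.integral_comp_mul_left (fun x => G ⌊x⌋₊) hN.ne', mul_zero, mul_one,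
    smul_eq_mul, div_eq_inv_mul]
  congr 1
  have hfl : ∀ j : ℕ, EqOn (fun x : ℝ => G ⌊x⌋₊) (fun _ => G j) (Ioo (j : ℝ) ((j + 1 : ℕ) : ℝ)) := by
    intro j x hx
    have : ⌊x⌋₊ = j := by
      rw [Nat.floor_eq_iff (le_trans (Nat.cast_nonneg j) hx.1.le)]
      exact ⟨hx.1.le, by have := hx.2; push_cast at this; exact this⟩
    simp only [this]
  have hle : ∀ j : ℕ, (j : ℝ) ≤ ((j + 1 : ℕ) : ℝ) := fun j => by push_cast; linarith
  have h := intervalIntegral.sum_integral_adjacent_intervals (μ := volume)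
    (f := fun x : ℝ => G ⌊x⌋₊) (a := fun j : ℕ => (j : ℝ)) (n := N + 1) (by
      intro j _
      rw [intervalIntegrable_iff_integrableOn_Ioo_of_le (hle j)]
      refine IntegrableOn.congr_fun ?_ (hfl j).symm measurableSet_Ioo
      exact integrableOn_const (by simp))
  simp only [Nat.cast_zero] at h
  push_cast at h
  rw [← h]
  refine Finset.sum_congr rfl fun j _ => ?_
  have hle' := hle j
  have hfl' := hfl j
  push_cast at hle' hfl'
  rw [intervalIntegral.integral_of_le hle', ← Measure.restrict_congr_set Ioo_ae_eq_Ioc,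
    setIntegral_congr_fun measurableSet_Ioo hfl']
  simp

theorem tendsto_choose_floor_div (n : ℕ) {t : ℝ} (ht : 0 < t) :
    Tendsto (fun N : ℕ => (⌊((N : ℝ) + 1) * t⌋₊.choose n : ℝ) / (N.choose n : ℝ)) atTop
      (𝓝 (t ^ n)) := by
  have hN1 : Tendsto (fun N : ℕ => (N : ℝ) + 1) atTop atTop :=
    tendsto_atTop_add_const_right _ _ tendsto_natCast_atTop_atTop
  have hfl : Tendsto (fun N : ℕ => ⌊((N : ℝ) + 1) * t⌋₊) atTop atTop :=
    tendsto_nat_floor_atTop.comp (hN1.atTop_mul_const ht)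
  have h0 : Tendsto (fun m : ℕ => (m.choose n : ℝ) / (m : ℝ) ^ n) atTop
      (𝓝 (1 / (n.factorial : ℝ))) := by
    have h := (isEquivalent_choose n).div (Asymptotics.IsEquivalent.refl
      (u := fun m : ℕ => (m : ℝ) ^ n) (l := atTop))
    refine (h.tendsto_nhds_iff).mpr ?_
    refine Tendsto.congr' ?_ tendsto_const_nhds
    filter_upwards [eventually_gt_atTop 0] with m hm
    have : (m : ℝ) ≠ 0 := by exact_mod_cast hm.ne'
    simp only [Pi.div_apply]
    field_simp
  have hr : Tendsto (fun N : ℕ => (⌊((N : ℝ) + 1) * t⌋₊ : ℝ) / (N : ℝ)) atTop (𝓝 t) := by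
    have h1 := (tendsto_nat_floor_mul_div_atTop ht.le).comp hN1
    have h2 : Tendsto (fun N : ℕ => ((N : ℝ) + 1) / (N : ℝ)) atTop (𝓝 1) := by
      have := tendsto_const_nhds (x := (1 : ℝ)) (f := (atTop : Filter ℕ)) |>.add
        (tendsto_one_div_atTop_nhds_zero_nat (𝕜 := ℝ))
      rw [add_zero] at this
      refine this.congr' ?_
      filter_upwards [eventually_gt_atTop 0] with m hm
      have : (m : ℝ) ≠ 0 := by exact_mod_cast hm.ne'
      field_simp
    have h3 := h1.mul h2
    rw [mul_one] at h3
    refine h3.congr' ?_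
    filter_upwards [eventually_gt_atTop 0] with m hm
    have : (m : ℝ) ≠ 0 := by exact_mod_cast hm.ne'
    have : (m : ℝ) + 1 ≠ 0 := by positivity
    simp only [Function.comp_apply, mul_comm t]
    field_simp
  have hf : (1 / (n.factorial : ℝ)) ≠ 0 := by positivity
  have h := ((h0.comp hfl).div h0 hf).mul (hr.pow n)
  rw [div_self hf, one_mul] at h
  refine h.congr' ?_
  filter_upwards [eventually_gt_atTop 0, hfl.eventually_gt_atTop 0, eventually_ge_atTop n]
    with m hm hm' hmn
  have h1 : (m : ℝ) ≠ 0 := by exact_mod_cast hm.ne'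
  have h2 : ((⌊((m : ℝ) + 1) * t⌋₊ : ℕ) : ℝ) ≠ 0 := by exact_mod_cast hm'.ne'
  have h3 : (m.choose n : ℝ) ≠ 0 := by exact_mod_cast (Nat.choose_pos hmn).ne'
  simp only [Pi.div_apply, Function.comp_apply, div_pow]
  field_simp

/-- The sum is the integral of a step function converging pointwise to `f(tⁿ)`, by `C(m,n) ~ mⁿ/n!`
and continuity of `f` inside `(0,1)`; dominated convergence applies since `f` is bounded. For `n =
0` the argument is the endpoint `1`, where `f` may jump, but both sides equal `f 1`. -/
theorem tendsto_sum_choose {f : ℝ → ℝ} (hf : ConcaveOn ℝ (Icc 0 1) f) (n : ℕ) :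
    Tendsto (fun N : ℕ => (∑ i ∈ Finset.range (N + 1),
      f (((N - i).choose n : ℝ) / (N.choose n : ℝ))) / (N + 1)) atTop
      (𝓝 (∫ t in Ioo (0 : ℝ) 1, f (t ^ n))) := by
  rcases Nat.eq_zero_or_pos n with rfl | hn
  · refine Tendsto.congr (fun N => ?_) tendsto_const_nhds
    have : (N : ℝ) + 1 ≠ 0 := by positivity
    simp
    field_simp
  obtain ⟨M, hM⟩ := hf.exists_abs_le
  have e : ∀ N : ℕ, (∑ i ∈ Finset.range (N + 1),
      f (((N - i).choose n : ℝ) / (N.choose n : ℝ))) / (N + 1)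
      = ∫ t in Ioo (0 : ℝ) 1, f ((⌊((N : ℝ) + 1) * t⌋₊.choose n : ℝ) / (N.choose n : ℝ)) := by
    intro N
    rw [integral_comp_floor_mul (fun j => f ((j.choose n : ℝ) / (N.choose n : ℝ))),
      ← Finset.sum_range_reflect]
    congr 1
    refine Finset.sum_congr rfl fun j hj => ?_
    have : N - (N + 1 - 1 - j) = j := by simp at hj; omega
    rw [this]
  simp_rw [e]
  refine tendsto_integral_filter_of_dominated_convergence (fun _ => M) ?_ ?_ ?_ ?_
  · refine Eventually.of_forall fun N => Measurable.aestronglyMeasurable ?_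
    exact (measurable_from_nat (f := fun j : ℕ => f ((j.choose n : ℝ) / (N.choose n : ℝ)))).comp
      (Nat.measurable_floor.comp (measurable_const.mul measurable_id))
  · filter_upwards [eventually_ge_atTop n] with N hN
    filter_upwards [ae_restrict_mem measurableSet_Ioo] with t ht
    refine hM _ ⟨by positivity, div_le_one_of_le₀ ?_ (by positivity)⟩
    have : ⌊((N : ℝ) + 1) * t⌋₊ ≤ N := by
      rw [← Nat.lt_succ_iff, Nat.floor_lt' (by omega)]
      push_cast
      have : (0 : ℝ) < (N : ℝ) + 1 := by positivity
      nlinarith [ht.2]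
    exact_mod_cast Nat.choose_le_choose n this
  · exact integrable_const _
  · filter_upwards [ae_restrict_mem measurableSet_Ioo] with t ht
    have hc : ContinuousAt f (t ^ n) := hf.continuousOn_Ioo.continuousAt
      (Ioo_mem_nhds (pow_pos ht.1 n) (pow_lt_one₀ ht.1.le ht.2 hn.ne'))
    exact hc.tendsto.comp (tendsto_choose_floor_div n ht.1)

end BlochCoherent

end

/-! ### The coherent average, rotation invariance, and the inequality on `[0,1]`. -/

noncomputable section

namespace BlochCoherent

open MeasureTheory Set Real Filter Topology
open scoped ENNReal Pointwise

theorem inner_mem_Icc (ω ω₀ : S2) : (1 + inner ℝ ω.1 ω₀.1) / 2 ∈ Icc (0 : ℝ) 1 := by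
  have h := abs_real_inner_le_norm ω.1 ω₀.1
  rw [norm_eq_of_mem_sphere, norm_eq_of_mem_sphere, mul_one, abs_le] at h
  constructor <;> linarith [h.1, h.2]

theorem inner_north (ω : S2) : inner ℝ ω.1 north.1 = ω.1 2 := by
  rw [PiLp.inner_apply, Fin.sum_univ_three]
  simp [north]

theorem averageFinite_coherentProj {f : ℝ → ℝ} (hf : ConcaveOn ℝ (Icc 0 1) f) (n : ℕ) (ω₀ : S2) :
    AverageFinite f (coherentProj n ω₀) := by
  refine integrable_comp_of_concaveOn hf (measurable_lowerSymbol _) fun ω => ?_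
  rw [lowerSymbol_coherentProj]
  have h := inner_mem_Icc ω ω₀
  exact ⟨pow_nonneg h.1 n, pow_le_one₀ h.1 h.2⟩

theorem exists_measurable_height {f : ℝ → ℝ} (hf : ContinuousOn f (Ioo 0 1)) (n : ℕ) :
    ∃ g : ℝ → ℝ, Measurable g ∧ (∀ t ∈ Ioo (0 : ℝ) 1, g t = f (t ^ n)) ∧
      (fun ω => f (lowerSymbol (coherentProj n north) ω)) = fun ω : S2 => g ((1 + ω.1 2) / 2) := by
  obtain ⟨g, hg, hfg⟩ := exists_measurable_eqOn hf
  refine ⟨fun t => g (t ^ n), hg.comp (measurable_id.pow_const n), fun t ht => ?_, ?_⟩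
  · exact (hfg ⟨pow_nonneg ht.1.le n, pow_le_one₀ ht.1.le ht.2.le⟩).symm
  · ext ω
    have h := inner_mem_Icc ω north
    rw [lowerSymbol_coherentProj]
    simp only [← inner_north]
    exact hfg ⟨pow_nonneg h.1 n, pow_le_one₀ h.1 h.2⟩

theorem integral_coherentProj_north {f : ℝ → ℝ} (hf : ContinuousOn f (Ioo 0 1)) (n : ℕ) :
    ∫ ω, f (lowerSymbol (coherentProj n north) ω) ∂surface
      = 4 * π * ∫ t in Ioo (0 : ℝ) 1, f (t ^ n) := by
  obtain ⟨g, hg, hgf, e⟩ := exists_measurable_height hf n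
  rw [e, integral_surface_height g hg, setIntegral_congr_fun measurableSet_Ioo hgf]

theorem integrableOn_of_averageFinite {f : ℝ → ℝ} (hf : ContinuousOn f (Ioo 0 1)) {n : ℕ}
    (h : AverageFinite f (coherentProj n north)) :
    IntegrableOn (fun t => f (t ^ n)) (Ioo 0 1) := by
  obtain ⟨g, hg, hgf, e⟩ := exists_measurable_height hf n
  rw [AverageFinite, e] at h
  have hm : Measurable fun ω : S2 => (1 + ω.1 2) / 2 := by
    have : Measurable fun ω : S2 => ω.1 2 := by fun_prop
    fun_prop
  have h2 := (integrable_map_measure (f := fun ω : S2 => (1 + ω.1 2) / 2) (μ := surface)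
    hg.aestronglyMeasurable hm.aemeasurable).mpr h
  rw [map_height_surface, integrable_smul_measure (by simp [pi_pos]) ENNReal.ofReal_ne_top] at h2
  exact IntegrableOn.congr_fun h2 hgf measurableSet_Ioo

theorem integral_coherentProj_le {f : ℝ → ℝ} (hf : ConcaveOn ℝ (Icc 0 1) f) {n : ℕ}
    {ρ : SpinSpace n →ₗ[ℂ] SpinSpace n} (hρ : IsDensity ρ) :
    4 * π * ∫ t in Ioo (0 : ℝ) 1, f (t ^ n) ≤ ∫ ω, f (lowerSymbol ρ ω) ∂surface := by
  refine le_of_tendsto ((tendsto_sum_choose hf n).const_mul (4 * π)) ?_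
  filter_upwards [eventually_ge_atTop n] with N hN
  exact sum_le_integral_lowerSymbol hf (Nat.add_sub_cancel' hN) hρ

/-- The action of a linear isometry on the sphere. -/
def sphereMap (U : R3 ≃ₗᵢ[ℝ] R3) (ω : S2) : S2 := ⟨U ω.1, by simp⟩

theorem measurePreserving_sphereMap (U : R3 ≃ₗᵢ[ℝ] R3) :
    MeasurePreserving (sphereMap U) surface surface := by
  have hm : Measurable (sphereMap U) :=
    (U.continuous.comp continuous_subtype_val).subtype_mk _ |>.measurable
  refine ⟨hm, ?_⟩
  ext s hs
  rw [Measure.map_apply hm hs, surface, Measure.toSphere_apply' _ (hm hs),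
    Measure.toSphere_apply' _ hs]
  congr 1
  rw [← U.measurePreserving.measure_preimage (measurableSet_cone hs).nullMeasurableSet]
  congr 1
  ext x
  constructor
  · rintro ⟨t, ht, _, ⟨y, hy, rfl⟩, rfl⟩
    exact ⟨t, ht, _, ⟨_, hy, rfl⟩, by simp [sphereMap]⟩
  · rintro ⟨t, ht, _, ⟨y, hy, rfl⟩, h⟩
    have hx : x = t • U.symm y.1 := by
      apply U.injective
      rw [map_smul, U.apply_symm_apply]
      exact h.symm
    refine ⟨t, ht, _, ⟨⟨U.symm y.1, by simp⟩, ?_, rfl⟩, hx.symm⟩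
    have : sphereMap U ⟨U.symm y.1, by simp⟩ = y := Subtype.ext (by simp [sphereMap])
    simpa [mem_preimage, this] using hy

theorem integral_coherentProj_eq {f : ℝ → ℝ} (hf : ConcaveOn ℝ (Icc 0 1) f) (n : ℕ) (ω₀ : S2) :
    ∫ ω, f (lowerSymbol (coherentProj n ω₀) ω) ∂surface
      = ∫ ω, f (lowerSymbol (coherentProj n north) ω) ∂surface := by
  -- A reflection serves as well as a rotation, since the symbol depends only on `ω·ω₀`.
  obtain ⟨U, hU⟩ : ∃ U : R3 ≃ₗᵢ[ℝ] R3, U ω₀.1 = north.1 :=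
    ⟨_, Submodule.reflection_sub (v := ω₀.1) (w := north.1)
      (by rw [norm_eq_of_mem_sphere, norm_eq_of_mem_sphere])⟩
  have hp := measurePreserving_sphereMap U
  have h := integral_map (μ := surface) hp.measurable.aemeasurable
    (f := fun ω => f (lowerSymbol (coherentProj n north) ω))
    (by rw [hp.map_eq]; exact (averageFinite_coherentProj hf n north).aestronglyMeasurable)
  rw [hp.map_eq] at h
  rw [h]
  refine integral_congr_ae (Eventually.of_forall fun ω => ?_)
  simp only [lowerSymbol_coherentProj, sphereMap, ← hU, U.inner_map_map]

/-! ### Concave functions on `[0,1)`. -/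

theorem concaveOn_neg_indicator_one :
    ConcaveOn ℝ (Icc (0 : ℝ) 1) (fun t => if t = 1 then (-1 : ℝ) else 0) := by
  refine ⟨convex_Icc 0 1, fun x hx y hy a b ha hb hab => ?_⟩
  simp only [smul_eq_mul]
  by_cases h : a * x + b * y = 1
  · rw [if_pos h]
    have h1 : a * (1 - x) + b * (1 - y) = 0 := by linear_combination hab - h
    have h2 : 0 ≤ a * (1 - x) := mul_nonneg ha (by linarith [hx.2])
    have h3 : 0 ≤ b * (1 - y) := mul_nonneg hb (by linarith [hy.2])
    have h4 : a * (1 - x) = 0 := by linarith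
    have h5 : b * (1 - y) = 0 := by linarith
    have h6 : a * (if x = 1 then (-1 : ℝ) else 0) = -a := by
      rcases mul_eq_zero.mp h4 with h | h
      · simp [h]
      · rw [if_pos (by linarith)]; ring
    have h7 : b * (if y = 1 then (-1 : ℝ) else 0) = -b := by
      rcases mul_eq_zero.mp h5 with h | h
      · simp [h]
      · rw [if_pos (by linarith)]; ring
    rw [h6, h7]; linarith
  · rw [if_neg h]
    have : ∀ z : ℝ, (if z = 1 then (-1 : ℝ) else 0) ≤ 0 := fun z => by split_ifs <;> norm_num
    nlinarith [mul_nonneg ha (neg_nonneg.mpr (this x)), mul_nonneg hb (neg_nonneg.mpr (this y))]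

/-- The inequality on `[0,1]` is applied to the concave function `-1_{t = 1}`: its coherent average
is zero, so the set where the symbol equals `1` is null. Thus the value of `f` at `1` is immaterial
for `n > 0`. -/
theorem ae_lowerSymbol_lt_one {n : ℕ} (hn : 0 < n) {ρ : SpinSpace n →ₗ[ℂ] SpinSpace n}
    (hρ : IsDensity ρ) : ∀ᵐ ω ∂surface, lowerSymbol ρ ω < 1 := by
  have h := integral_coherentProj_le concaveOn_neg_indicator_one hρ
  have e : ∫ t in Ioo (0 : ℝ) 1, (if t ^ n = 1 then (-1 : ℝ) else 0) = 0 := by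
    rw [setIntegral_congr_fun (g := fun _ => (0 : ℝ)) measurableSet_Ioo fun t ht =>
      if_neg (pow_lt_one₀ ht.1.le ht.2 hn.ne').ne]
    simp
  rw [e, mul_zero] at h
  have hint : Integrable (fun ω => -(if lowerSymbol ρ ω = 1 then (-1 : ℝ) else 0)) surface :=
    (averageFinite_of_concaveOn concaveOn_neg_indicator_one hρ).neg
  have h0 : ∀ ω, 0 ≤ -(if lowerSymbol ρ ω = 1 then (-1 : ℝ) else 0) := by
    intro ω; split_ifs <;> norm_num
  have h1 : ∫ ω, -(if lowerSymbol ρ ω = 1 then (-1 : ℝ) else 0) ∂surface = 0 := by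
    refine le_antisymm ?_ (integral_nonneg h0)
    rw [integral_neg]
    linarith
  filter_upwards [(integral_eq_zero_iff_of_nonneg h0 hint).mp h1] with ω hω
  refine lt_of_le_of_ne (lowerSymbol_mem_Icc hρ ω).2 fun h' => ?_
  simp [h'] at hω

theorem lowerSymbol_spin_zero {ρ : SpinSpace 0 →ₗ[ℂ] SpinSpace 0}
    (hρ : LinearMap.trace ℂ (SpinSpace 0) ρ = 1) (ω : S2) : lowerSymbol ρ ω = 1 := by
  rw [lowerSymbol_eq ρ (isSpinor_spinor ω)]
  have e : coherentVec 0 (spinorA ω) (spinorB ω) = EuclideanSpace.basisFun (Fin 1) ℂ 0 := by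
    ext i
    fin_cases i
    simp [coherentVec, ofCoeffs]
  rw [LinearMap.trace_eq_sum_inner ρ (EuclideanSpace.basisFun (Fin 1) ℂ), Fin.sum_univ_one] at hρ
  rw [e, hρ, Complex.one_re]

theorem _root_.ConcaveOn.comp_mul_left {f : ℝ → ℝ} (hf : ConcaveOn ℝ (Ico 0 1) f) {s : ℝ}
    (hs0 : 0 ≤ s) (hs1 : s < 1) : ConcaveOn ℝ (Icc 0 1) fun t => f (s * t) := by
  have hmem : ∀ t ∈ Icc (0 : ℝ) 1, s * t ∈ Ico (0 : ℝ) 1 := fun t ht =>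
    ⟨mul_nonneg hs0 ht.1, by nlinarith [ht.1, ht.2]⟩
  refine ⟨convex_Icc 0 1, fun x hx y hy a b ha hb hab => ?_⟩
  have := hf.2 (hmem x hx) (hmem y hy) ha hb hab
  simp only [smul_eq_mul] at this ⊢
  rwa [show s * (a * x + b * y) = a * (s * x) + b * (s * y) by ring]

/-- The midpoint of `0` and `t` stays in `[0,1/2]`, where `f` is bounded; concavity there bounds `f
t` from above. -/
theorem _root_.ConcaveOn.exists_le_Ico {f : ℝ → ℝ} (hf : ConcaveOn ℝ (Ico 0 1) f) :
    ∃ M, ∀ t ∈ Ico (0 : ℝ) 1, f t ≤ M := by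
  obtain ⟨M, hM⟩ := (hf.comp_mul_left (s := 1 / 2) (by norm_num) (by norm_num)).exists_abs_le
  refine ⟨2 * M - f 0, fun t ht => ?_⟩
  have h1 := (abs_le.mp (hM t ⟨ht.1, ht.2.le⟩)).2
  have h2 := hf.2 (show (0 : ℝ) ∈ Ico (0 : ℝ) 1 by simp) ht (by norm_num : (0 : ℝ) ≤ 1 / 2)
    (by norm_num : (0 : ℝ) ≤ 1 / 2) (by norm_num)
  simp only [smul_eq_mul, mul_zero, zero_add] at h2
  linarith

theorem surface_real_univ : surface.real univ = 4 * π := by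
  have h := integral_surface_height (fun _ => 1) measurable_const
  simpa using h

/-- The case of a concave function on `[0,1)`. -/
theorem integrable_and_integral_le_of_concaveOn_Ico {f : ℝ → ℝ} (hf : ConcaveOn ℝ (Ico 0 1) f)
    {n : ℕ} (hn : 0 < n) (hfin : AverageFinite f (coherentProj n north))
    {ρ : SpinSpace n →ₗ[ℂ] SpinSpace n} (hρ : IsDensity ρ) :
    AverageFinite f ρ ∧ 4 * π * ∫ t in Ioo (0 : ℝ) 1, f (t ^ n)
      ≤ ∫ ω, f (lowerSymbol ρ ω) ∂surface := by
  have hc : ContinuousOn f (Ioo 0 1) := by simpa using hf.continuousOn_interior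
  obtain ⟨M, hM⟩ := hf.exists_le_Ico
  have hfi := integrableOn_of_averageFinite hc hfin
  have hlt := ae_lowerSymbol_lt_one hn hρ
  -- Each `t ↦ f(s m · t)` is concave on all of `[0,1]`, so the inequality already proved applies to
  -- it.
  set s : ℕ → ℝ := fun m => 1 - 1 / ((m : ℝ) + 1) with hs
  have hs0 : ∀ m, 0 ≤ s m := fun m => by
    have : 1 / ((m : ℝ) + 1) ≤ 1 := by
      rw [div_le_one (by positivity)]; linarith [Nat.cast_nonneg (α := ℝ) m]
    simp only [hs]; linarith
  have hs1 : ∀ m, s m < 1 := fun m => by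
    have : 0 < 1 / ((m : ℝ) + 1) := by positivity
    simp only [hs]; linarith
  have hst : Tendsto s atTop (𝓝 1) := by
    have := (tendsto_const_nhds (x := (1 : ℝ))).sub
      (tendsto_one_div_add_atTop_nhds_zero_nat (𝕜 := ℝ))
    rwa [sub_zero] at this
  have hlim : ∀ x ∈ Ico (0 : ℝ) 1, Tendsto (fun m => f (s m * x)) atTop (𝓝 (f x)) := by
    intro x hx
    rcases hx.1.eq_or_lt with h | h
    · simp [← h]
    · have hca : ContinuousAt f x := hc.continuousAt (Ioo_mem_nhds h hx.2)
      have := hst.mul_const x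
      rw [one_mul] at this
      exact hca.tendsto.comp this
  have hfs : ∀ m, ConcaveOn ℝ (Icc 0 1) fun t => f (s m * t) :=
    fun m => hf.comp_mul_left (hs0 m) (hs1 m)
  have hmem : ∀ m, ∀ t ∈ Icc (0 : ℝ) 1, s m * t ∈ Ico (0 : ℝ) 1 := fun m t ht =>
    ⟨mul_nonneg (hs0 m) ht.1, by nlinarith [ht.1, ht.2, hs0 m, hs1 m]⟩
  have htn : ∀ t ∈ Ioo (0 : ℝ) 1, t ^ n ∈ Ioo (0 : ℝ) 1 := fun t ht =>
    ⟨pow_pos ht.1 n, pow_lt_one₀ ht.1.le ht.2 hn.ne'⟩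
  have hB : Tendsto (fun m => ∫ t in Ioo (0 : ℝ) 1, f (s m * t ^ n)) atTop
      (𝓝 (∫ t in Ioo (0 : ℝ) 1, f (t ^ n))) := by
    -- Since `s m * t ^ n` lies between `0` and `t ^ n`, concavity gives the lower bound `min (f 0)
    -- (f (t ^ n))`, integrable by hypothesis; `M` bounds from above.
    refine tendsto_integral_of_dominated_convergence (fun t => |M| + |f 0| + |f (t ^ n)|) ?_ ?_ ?_ ?_
    · intro m
      refine ((integrable_comp_of_concaveOn (μ := volume.restrict (Ioo (0 : ℝ) 1)) (hfs m)
        (s := fun t => max 0 (min 1 (t ^ n))) (by fun_prop) fun t => ?_).congr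
          ?_).aestronglyMeasurable
      · exact ⟨le_max_left _ _, max_le zero_le_one (min_le_left _ _)⟩
      · filter_upwards [ae_restrict_mem measurableSet_Ioo] with t ht
        rw [min_eq_right (htn t ht).2.le, max_eq_right (htn t ht).1.le]
    · exact (integrable_const _).add hfi.abs
    · intro m
      filter_upwards [ae_restrict_mem measurableSet_Ioo] with t ht
      have h1 := htn t ht
      have h2 := hM _ (hmem m _ ⟨h1.1.le, h1.2.le⟩)
      have h3 : min (f 0) (f (t ^ n)) ≤ f (s m * t ^ n) :=
        hf.min_le_of_mem_Icc (by simp) ⟨h1.1.le, h1.2⟩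
          ⟨mul_nonneg (hs0 m) h1.1.le, by nlinarith [h1.1, hs1 m]⟩
      have h4 : -(|f 0| + |f (t ^ n)|) ≤ min (f 0) (f (t ^ n)) :=
        le_min (by linarith [neg_abs_le (f 0), abs_nonneg (f (t ^ n))])
          (by linarith [neg_abs_le (f (t ^ n)), abs_nonneg (f 0)])
      rw [Real.norm_eq_abs, abs_le]
      constructor
      · linarith [abs_nonneg M]
      · linarith [le_abs_self M, abs_nonneg (f 0), abs_nonneg (f (t ^ n))]
    · filter_upwards [ae_restrict_mem measurableSet_Ioo] with t ht
      exact hlim _ ⟨(htn t ht).1.le, (htn t ht).2⟩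
  set B : ℝ := 4 * π * M - 4 * π * ∫ t in Ioo (0 : ℝ) 1, f (t ^ n) with hBdef
  have hA : ∀ m, ∫ ω, (M - f (s m * lowerSymbol ρ ω)) ∂surface
      ≤ 4 * π * M - 4 * π * ∫ t in Ioo (0 : ℝ) 1, f (s m * t ^ n) := by
    intro m
    rw [integral_sub (integrable_const _) (averageFinite_of_concaveOn (hfs m) hρ), integral_const,
      surface_real_univ, smul_eq_mul]
    have := integral_coherentProj_le (hfs m) hρ
    linarith
  have hnn : ∀ m ω, 0 ≤ M - f (s m * lowerSymbol ρ ω) := fun m ω =>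
    sub_nonneg.mpr (hM _ (hmem m _ (lowerSymbol_mem_Icc hρ ω)))
  have hmeas : AEStronglyMeasurable (fun ω => M - f (lowerSymbol ρ ω)) surface := by
    obtain ⟨g, hg, hfg⟩ := exists_measurable_eqOn hc
    have e : (fun ω => M - f (lowerSymbol ρ ω)) = fun ω => M - g (lowerSymbol ρ ω) :=
      funext fun ω => by rw [hfg (lowerSymbol_mem_Icc hρ ω)]
    rw [e]
    exact (measurable_const.sub (hg.comp (measurable_lowerSymbol ρ))).aestronglyMeasurable
  have hnn' : ∀ᵐ ω ∂surface, 0 ≤ M - f (lowerSymbol ρ ω) := by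
    filter_upwards [hlt] with ω hω
    exact sub_nonneg.mpr (hM _ ⟨(lowerSymbol_mem_Icc hρ ω).1, hω⟩)
  -- Fatou's lemma for the nonnegative functions `M - f(s m · symbol)`; it yields integrability and
  -- the inequality together.
  have hF : ∫⁻ ω, ENNReal.ofReal (M - f (lowerSymbol ρ ω)) ∂surface ≤ ENNReal.ofReal B := by
    have hfatou := lintegral_liminf_le' (μ := surface) (u := (atTop : Filter ℕ))
      (f := fun m ω => ENNReal.ofReal (M - f (s m * lowerSymbol ρ ω))) fun m =>
        ((aestronglyMeasurable_const (b := M)).sub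
          (averageFinite_of_concaveOn (hfs m) hρ).aestronglyMeasurable).aemeasurable.ennreal_ofReal
    calc ∫⁻ ω, ENNReal.ofReal (M - f (lowerSymbol ρ ω)) ∂surface
        = ∫⁻ ω, liminf (fun m => ENNReal.ofReal (M - f (s m * lowerSymbol ρ ω))) atTop ∂surface := by
          refine lintegral_congr_ae ?_
          filter_upwards [hlt] with ω hω
          refine (Tendsto.liminf_eq ?_).symm
          exact (ENNReal.continuous_ofReal.tendsto _).comp
            (tendsto_const_nhds.sub (hlim _ ⟨(lowerSymbol_mem_Icc hρ ω).1, hω⟩))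
      _ ≤ _ := hfatou
      _ ≤ liminf (fun m => ENNReal.ofReal
            (4 * π * M - 4 * π * ∫ t in Ioo (0 : ℝ) 1, f (s m * t ^ n))) atTop := by
          refine liminf_le_liminf (Eventually.of_forall fun m => ?_)
          have hi : Integrable (fun ω => M - f (s m * lowerSymbol ρ ω)) surface :=
            (integrable_const M).sub (averageFinite_of_concaveOn (hfs m) hρ)
          rw [← ofReal_integral_eq_lintegral_ofReal hi (Eventually.of_forall (hnn m))]
          exact ENNReal.ofReal_le_ofReal (hA m)
      _ = ENNReal.ofReal B := by
          refine Tendsto.liminf_eq ?_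
          exact (ENNReal.continuous_ofReal.tendsto _).comp
            (tendsto_const_nhds.sub (hB.const_mul (4 * π)))
  have hint : Integrable (fun ω => M - f (lowerSymbol ρ ω)) surface := by
    refine ⟨hmeas, ?_⟩
    rw [hasFiniteIntegral_iff_ofReal hnn']
    exact hF.trans_lt ENNReal.ofReal_lt_top
  have hint' : AverageFinite f ρ := by
    have := (integrable_const (μ := surface) M).sub hint
    refine this.congr (Eventually.of_forall fun ω => ?_)
    simp
  refine ⟨hint', ?_⟩
  have hB0 : 0 ≤ B := by
    have h1 : ∫ t in Ioo (0 : ℝ) 1, f (t ^ n) ≤ ∫ t in Ioo (0 : ℝ) 1, M :=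
      setIntegral_mono_on hfi (by simp) measurableSet_Ioo
        fun t ht => hM _ ⟨(htn t ht).1.le, (htn t ht).2⟩
    have h2 : ∫ t in Ioo (0 : ℝ) 1, M = M := by simp
    rw [h2] at h1
    have := pi_pos
    rw [hBdef, ← mul_sub]
    exact mul_nonneg (by positivity) (by linarith)
  rw [← ofReal_integral_eq_lintegral_ofReal hint hnn', ENNReal.ofReal_le_ofReal_iff hB0,
    integral_sub (integrable_const _) hint', integral_const, surface_real_univ, smul_eq_mul] at hF
  linarith

end BlochCoherent

end

theorem theorem2p1 (n : ℕ)
    (ρ : BlochCoherent.SpinSpace n →ₗ[ℂ] BlochCoherent.SpinSpace n)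
    (hρ : BlochCoherent.IsDensity ρ) :
    (∀ f : ℝ → ℝ, ConcaveOn ℝ (Set.Icc 0 1) f →
      BlochCoherent.AverageFinite f ρ ∧
      BlochCoherent.AverageFinite f (BlochCoherent.coherentProj n BlochCoherent.north) ∧
      BlochCoherent.average f (BlochCoherent.coherentProj n BlochCoherent.north)
        ≤ BlochCoherent.average f ρ ∧
      ∀ ω₀ : BlochCoherent.S2,
        BlochCoherent.AverageFinite f (BlochCoherent.coherentProj n ω₀) ∧
        BlochCoherent.average f (BlochCoherent.coherentProj n ω₀)
          = BlochCoherent.average f (BlochCoherent.coherentProj n BlochCoherent.north)) ∧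
    (∀ f : ℝ → ℝ, ConcaveOn ℝ (Set.Ico 0 1) f →
      BlochCoherent.AverageFinite f (BlochCoherent.coherentProj n BlochCoherent.north) →
      BlochCoherent.AverageFinite f ρ ∧
      BlochCoherent.average f (BlochCoherent.coherentProj n BlochCoherent.north)
        ≤ BlochCoherent.average f ρ) := by
  have hπ := Real.pi_pos
  constructor
  · intro f hf
    refine ⟨BlochCoherent.averageFinite_of_concaveOn hf hρ,
      BlochCoherent.averageFinite_coherentProj hf n _, ?_, fun ω₀ =>
      ⟨BlochCoherent.averageFinite_coherentProj hf n _, ?_⟩⟩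
    · unfold BlochCoherent.average
      rw [BlochCoherent.integral_coherentProj_north hf.continuousOn_Ioo]
      exact mul_le_mul_of_nonneg_left (BlochCoherent.integral_coherentProj_le hf hρ) (by positivity)
    · unfold BlochCoherent.average
      rw [BlochCoherent.integral_coherentProj_eq hf]
  · intro f hf hfin
    -- For spin zero every symbol is identically `1`, where `f` is arbitrary, so the two averages
    -- are literally equal.
    rcases Nat.eq_zero_or_pos n with rfl | hn
    · have e : ∀ ω, BlochCoherent.lowerSymbol ρ ω
          = BlochCoherent.lowerSymbol (BlochCoherent.coherentProj 0 BlochCoherent.north) ω := by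
        intro ω
        rw [BlochCoherent.lowerSymbol_spin_zero hρ.2, BlochCoherent.lowerSymbol_coherentProj,
          pow_zero]
      constructor
      · simpa only [BlochCoherent.AverageFinite, e] using hfin
      · simp only [BlochCoherent.average, e, le_refl]
    · obtain ⟨h1, h2⟩ :=
        BlochCoherent.integrable_and_integral_le_of_concaveOn_Ico hf hn hfin hρ
      refine ⟨h1, ?_⟩
      unfold BlochCoherent.average
      rw [BlochCoherent.integral_coherentProj_north (by simpa using hf.continuousOn_interior)]
      exact mul_le_mul_of_nonneg_left h2 (by positivity)
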